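/- Let $G$ be a finite group and $K\le G$ a subgroup. All representations are finite-dimensional and complex. Let $D(G)$ be the quantum double, with basis $D^{(h,g)}=B^hA^g$ ($h,g\in G$) and product $D^{(h_1,g_1)}D^{(h_2,g_2)}=\delta_{h_1,\,g_1h_2g_1^{-1}}D^{(h_1,g_1g_2)}$. Let $Z=Z(G,1,K,1)$ be the algebra with basis $Z^{(hK,k)}$ ($hK\in G/K$, $k\in K$) and product $Z^{(h_1K,k_1)}Z^{(h_2K,k_2)}=\delta_{h_1K,\,k_1h_2K}Z^{(h_1K,k_1k_2)}$, embedded in $D(G)$ by $Z^{(hK,k)}\mapsto\sum_{j\in hK}D^{(j,k)}$. Let $F^{(h,g)}\in D(G)^*$ and $Y^{(hK,k)}\in Z^*$ be the dual bases (the ribbon operators in the bulk and on the boundary). Pushing into the boundary is the restriction map $D(G)^*\to Z^*$; it sends $F^{(h,g)}$ to $Y^{(hK,g)}$ if $g\in K$ and to $0$ otherwise. A bulk excitation $(C,\pi)$ is a conjugacy class $C$ of $G$ with representative $r_C$, and an irreducible representation $\pi$ of the centralizer $E(C)$ of $r_C$. Let $p_i$ be representatives of $G/E(C)$, let $c_i=p_ir_Cp_i^{-1}$,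 and for $\mathbf u=(i,j)$, $\mathbf v=(i',j')$ let $$F^{(C,\pi);(\mathbf u,\mathbf v)}=\frac{\dim\pi}{|E(C)|}\sum_{k\in E(C)}\big(\Gamma_\pi(k)^{-1}\big)_{jj'}F^{(c_i,\;p_ikp_{i'}^{-1})},$$ where $\Gamma_\pi(k)$ is the matrix of $\pi(k)$ in a fixed basis. The associated irreducible representation of $D(G)$, also written $(C,\pi)$, is induced from $\pi$ and graded by $C$: it is the space of $f:G\to V_\pi$ with $f(ge)=\pi(e)^{-1}f(g)$ for $e\in E(C)$, on which $A^x$ acts by left translation and $B^h$ restricts $f$ to $\{g: gr_Cg^{-1}=h\}$. For each double coset $T\in K\backslash G/K$ fix a representative $r_T$, and let $K^{r_T}=K\cap r_TKr_T^{-1}$. A boundary excitation $(T,R)$ is a double coset $T$ with an irreducible representation $R$ of $K^{r_T}$, up to isomorphism. Let $q_i$ be representatives of $K/K^{r_T}$, let $s_i=q_ir_Tq_i^{-1}$, and let $$Y^{(T,R);(\mathbf u,\mathbf v)}=\frac{\dim R}{|K^{r_T}|}\sum_{k\in K^{r_T}}\big(\Gamma_R(k)^{-1}\big)_{jj'}Y^{(s_iK,\;q_ikq_{i'}^{-1})}.$$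 The associated representation $(T,R)$ of $Z$ is the space of $f:K\to V_R$ with $f(ks)=R(s)^{-1}f(k)$ for $s\in K^{r_T}$, on which $Z^{(hK,j)}$ acts by left translation by $j$ followed by restriction to $\{k: kr_TK=hK\}$. The quantum dimensions are $\mathrm{FPdim}(C,\pi)=|C|\dim\pi$ and $\mathrm{FPdim}(T,R)=\frac{|K|}{|K^{r_T}|}\dim R$. For $x\in G$ let $x\triangleright\pi$ be the representation of $xE(C)x^{-1}$ in which $y$ acts as $\pi(x^{-1}yx)$. For an irreducible representation $\sigma$ of $xE(C)x^{-1}\cap K^{r_T}$ let $n^{x\triangleright\pi}_\sigma$ and $n^R_\sigma$ be the multiplicities of $\sigma$ in the restrictions of $x\triangleright\pi$ and $R$ to this group. **Theorem.** Fix a bulk excitation $(C,\pi)$. (a) The images in $Z^*$ of the $F^{(C,\pi);(\mathbf u_1,\mathbf v_1)}$ have unique expansions in the $Y^{(T,R);(\mathbf u_2,\mathbf v_2)}$. The coefficient of $Y^{(T,R);(\mathbf u_2,\mathbf v_2)}$ in the image of $F^{(C,\pi);(\mathbf u_1,\mathbf v_1)}$ is nonzero for some $\mathbf u_1,\mathbf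 v_1,\mathbf u_2,\mathbf v_2$ if and only if the following two conditions hold: 1. $C\cap T\neq\emptyset$; 2. there are an $x\in G$ with $xr_Cx^{-1}\in r_TK$ and an irreducible representation $\sigma$ of $xE(C)x^{-1}\cap K^{r_T}$ such that $n^{x\triangleright\pi}_\sigma\ne0$ and $n^R_\sigma\neq 0$. (b) Let $X(C)$ be a set of representatives of $K\backslash G/E(C)$, chosen so that every $x\in X(C)$ satisfies $xr_Cx^{-1}\in r_TK$, where $T=Kxr_Cx^{-1}K$ (such a choice always exists). The restriction of $(C,\pi)$ to $Z$ decomposes as $$(C,\pi)\cong\bigoplus_{(T,R)}n^{(C,\pi)}_{(T,R)}\,(T,R),$$ and the multiplicities are uniquely determined and given by $$n^{(C,\pi)}_{(T,R)}=\sum_{\substack{x\in X(C),\ xr_Cx^{-1}\in T\\ \sigma\in (xE(C)x^{-1}\cap K^{r_T})_{\mathrm{ir}}}}n^R_\sigma\, n^{x\triangleright\pi}_\sigma .$$ (c) Both sides have the same quantum dimension: $\mathrm{FPdim}(C,\pi)=\sum_{(T,R)}n^{(C,\pi)}_{(T,R)}\,\mathrm{FPdim}(T,R)$. -/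

import Mathlib

noncomputable section

open scoped Classical

set_option linter.unusedSectionVars false

/-! ### Algebras of local operators -/

/-- The algebra `F[X] ⊗ ℂ[H]` of a finite group `H` acting on a set `X`: an element is a family of
coefficients `a x g` on the basis vectors `(x, g)` ("project to `x`, after acting by `g`"). -/
def ActionAlgebra (X H : Type*) : Type _ := X → H → ℂ

namespace ActionAlgebra

variable {X H : Type*}

instance : AddCommGroup (ActionAlgebra X H) := inferInstanceAs (AddCommGroup (X → H → ℂ))

instance : Module ℂ (ActionAlgebra X H) := inferInstanceAs (Module ℂ (X → H → ℂ))

@[ext]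
theorem ext {a b : ActionAlgebra X H} (h : ∀ x g, a x g = b x g) : a = b :=
  funext fun x => funext fun g => h x g

@[simp] theorem add_apply (a b : ActionAlgebra X H) (x : X) (g : H) :
    (a + b) x g = a x g + b x g := rfl

@[simp] theorem zero_apply (x : X) (g : H) : (0 : ActionAlgebra X H) x g = 0 := rfl

@[simp] theorem smul_apply (r : ℂ) (a : ActionAlgebra X H) (x : X) (g : H) :
    (r • a) x g = r * a x g := rfl

/-- The basis vector `(x, g)`. -/
def single (x : X) (g : H) : ActionAlgebra X H := fun x' g' => if x' = x ∧ g' = g then 1 else 0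

/-- The coordinate functional dual to the basis vector `(x, g)`. -/
def coord (x : X) (g : H) : Module.Dual ℂ (ActionAlgebra X H) where
  toFun a := a x g
  map_add' _ _ := rfl
  map_smul' _ _ := rfl

variable [Group H] [Finite H] [MulAction H X]

/-- The product determined by `(x₁, g₁) (x₂, g₂) = δ_{x₁, g₁ • x₂} (x₁, g₁ g₂)`. -/
instance : Mul (ActionAlgebra X H) :=
  ⟨fun a b x g => ∑ᶠ j : H, a x j * b (j⁻¹ • x) (j⁻¹ * g)⟩

instance : One (ActionAlgebra X H) := ⟨fun _ g => if g = 1 then 1 else 0⟩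

theorem mul_apply (a b : ActionAlgebra X H) (x : X) (g : H) :
    (a * b) x g = ∑ᶠ j : H, a x j * b (j⁻¹ • x) (j⁻¹ * g) := rfl

theorem one_apply (x : X) (g : H) :
    (1 : ActionAlgebra X H) x g = if g = 1 then 1 else 0 := rfl

instance : Ring (ActionAlgebra X H) where
  __ := (inferInstance : AddCommGroup (ActionAlgebra X H))
  mul := (· * ·)
  one := 1
  left_distrib a b c := by
    have := Fintype.ofFinite H
    ext x g
    simp [mul_apply, finsum_eq_sum_of_fintype, mul_add, Finset.sum_add_distrib]
  right_distrib a b c := by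
    have := Fintype.ofFinite H
    ext x g
    simp [mul_apply, finsum_eq_sum_of_fintype, add_mul, Finset.sum_add_distrib]
  zero_mul a := by
    ext x g
    simp [mul_apply]
  mul_zero a := by
    ext x g
    simp [mul_apply]
  mul_assoc a b c := by
    have := Fintype.ofFinite H
    ext x g
    simp only [mul_apply, finsum_eq_sum_of_fintype, Finset.sum_mul, Finset.mul_sum]
    rw [Finset.sum_comm]
    refine Finset.sum_congr rfl fun j _ => ?_
    rw [← Equiv.sum_comp (Equiv.mulLeft j)]
    refine Finset.sum_congr rfl fun l _ => ?_
    simp [mul_smul, mul_assoc]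
  one_mul a := by
    have := Fintype.ofFinite H
    ext x g
    simp only [mul_apply, one_apply, finsum_eq_sum_of_fintype]
    rw [Finset.sum_eq_single 1] <;> simp +contextual
  mul_one a := by
    have := Fintype.ofFinite H
    ext x g
    simp only [mul_apply, one_apply, finsum_eq_sum_of_fintype]
    rw [Finset.sum_eq_single g]
    · simp
    · intro j _ hj
      rw [if_neg, mul_zero]
      intro h
      exact hj (inv_mul_eq_one.mp h)
    · simp

instance : Algebra ℂ (ActionAlgebra X H) :=
  Algebra.ofModule
    (fun r a b => by
      have := Fintype.ofFinite H
      ext x g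
      simp [mul_apply, finsum_eq_sum_of_fintype, Finset.mul_sum, mul_assoc])
    (fun r a b => by
      have := Fintype.ofFinite H
      ext x g
      simp [mul_apply, finsum_eq_sum_of_fintype, Finset.mul_sum, mul_left_comm])

theorem single_mul_single (x₁ x₂ : X) (g₁ g₂ : H) :
    single x₁ g₁ * single x₂ g₂ = if x₁ = g₁ • x₂ then single x₁ (g₁ * g₂) else 0 := by
  have := Fintype.ofFinite H
  ext x g
  simp only [mul_apply, single, finsum_eq_sum_of_fintype]
  rw [Finset.sum_eq_single g₁]
  · by_cases h : x₁ = g₁ • x₂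
    · rw [if_pos h]
      by_cases hx : x = x₁
      · subst hx
        simp [single, ← inv_smul_eq_iff.mpr h, inv_mul_eq_iff_eq_mul]
      · simp [single, hx]
    · rw [if_neg h]
      by_cases hx : x = x₁
      · subst hx
        simp [inv_smul_eq_iff, h]
      · simp [hx]
  · intro j _ hj
    simp [hj]
  · simp

/-- The vector space induced along `ι : S →* H` from a representation `ρ` of `S`. -/
def indSpace {S V : Type*} [Group S] [AddCommGroup V] [Module ℂ V] (ι : S →* H)
    (ρ : Representation ℂ S V) : Submodule ℂ (H → V) where
  carrier := {f | ∀ (h : H) (s : S), f (h * ι s) = ρ s⁻¹ (f h)}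
  add_mem' hf hg h s := by simp [hf h s, hg h s]
  zero_mem' h s := by simp
  smul_mem' r f hf h s := by simp [hf h s]

/-- The representation of `ActionAlgebra X H` on the induced space: when `ι` takes values in the
stabilizer of `x₀`, the value of `f` at `h` sits in degree `h • x₀`. The basis vector `(x, g)`
acts by left translation by `g`, followed by projection to degree `x`. -/
def indRep {S V : Type*} [Group S] [AddCommGroup V] [Module ℂ V] (ι : S →* H)
    (ρ : Representation ℂ S V) (x₀ : X) (hx₀ : ∀ s, ι s • x₀ = x₀) :
    ActionAlgebra X H →ₐ[ℂ] Module.End ℂ (indSpace ι ρ) :=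
  AlgHom.ofLinearMap
    { toFun := fun a =>
        { toFun := fun f => ⟨fun h => ∑ᶠ j : H, a (h • x₀) j • f.1 (j⁻¹ * h), by
            have := Fintype.ofFinite H
            intro h s
            simp only [finsum_eq_sum_of_fintype, map_sum, map_smul, mul_smul, hx₀]
            refine Finset.sum_congr rfl fun j _ => ?_
            rw [← mul_assoc, f.2 (j⁻¹ * h) s]⟩
          map_add' := fun f f' => by
            have := Fintype.ofFinite H
            ext h
            simp [finsum_eq_sum_of_fintype, Finset.sum_add_distrib]
          map_smul' := fun r f => by
            have := Fintype.ofFinite H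
            ext h
            simp [finsum_eq_sum_of_fintype, Finset.smul_sum, smul_comm r] }
      map_add' := fun a b => by
        have := Fintype.ofFinite H
        ext f h
        simp [finsum_eq_sum_of_fintype, Finset.sum_add_distrib, add_smul]
      map_smul' := fun r a => by
        have := Fintype.ofFinite H
        ext f h
        simp [finsum_eq_sum_of_fintype, Finset.smul_sum, mul_smul] }
    (by
      have := Fintype.ofFinite H
      ext f h
      simp only [LinearMap.coe_mk, AddHom.coe_mk, one_apply, finsum_eq_sum_of_fintype]
      rw [Finset.sum_eq_single 1] <;> simp +contextual)
    (fun a b => by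
      have := Fintype.ofFinite H
      ext f h
      simp only [LinearMap.coe_mk, AddHom.coe_mk, mul_apply, finsum_eq_sum_of_fintype,
        Finset.sum_smul, Finset.smul_sum, Module.End.mul_apply]
      rw [Finset.sum_comm]
      refine Finset.sum_congr rfl fun j _ => ?_
      rw [← Equiv.sum_comp (Equiv.mulLeft j)]
      refine Finset.sum_congr rfl fun l _ => ?_
      simp [mul_smul, mul_assoc])

end ActionAlgebra

open ActionAlgebra

/-- The quantum double `D(G) = F[G] ⊗ ℂ[G]`, where `G` acts on itself by conjugation. -/
abbrev QuantumDouble (G : Type*) [Group G] : Type _ := ActionAlgebra G (ConjAct G)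

/-- The algebra `Z(G,1,K,1) = F[G/K] ⊗ ℂ[K]` of local operators on the boundary. -/
abbrev BoundaryAlgebra {G : Type*} [Group G] (K : Subgroup G) : Type _ := ActionAlgebra (G ⧸ K) K

section Bulk

variable {G : Type*} [Group G]

instance [Finite G] : Finite (ConjAct G) := inferInstanceAs (Finite G)

/-- The basis element `D^{(h,g)} = B^h A^g`. -/
def opD (h g : G) : QuantumDouble G := single h (ConjAct.toConjAct g)

theorem opD_mul_opD [Finite G] (h₁ g₁ h₂ g₂ : G) :
    opD h₁ g₁ * opD h₂ g₂ = if h₁ = g₁ * h₂ * g₁⁻¹ then opD h₁ (g₁ * g₂) else 0 := by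
  rw [opD, opD, single_mul_single, ConjAct.toConjAct_smul, opD, map_mul]

/-- The basis element `Z^{(hK,k)} = B^{hK} A^k`. -/
def opZ {K : Subgroup G} (h : G) (k : K) : BoundaryAlgebra K := single (h : G ⧸ K) k

theorem opZ_mul_opZ [Finite G] {K : Subgroup G} (h₁ h₂ : G) (k₁ k₂ : K) :
    opZ h₁ k₁ * opZ h₂ k₂ =
      if (h₁ : G ⧸ K) = ((k₁ * h₂ : G) : G ⧸ K) then opZ h₁ (k₁ * k₂) else 0 := by
  rw [opZ, opZ, single_mul_single]
  have h : (k₁ • (h₂ : G ⧸ K)) = ((k₁ * h₂ : G) : G ⧸ K) := rfl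
  rw [h]
  split_ifs <;> rfl

/-- The map `Z(G,1,K,1) → D(G)` on coefficients: constant on left cosets of `K` in the first
variable, supported on `K` in the second. -/
def boundaryExtend (K : Subgroup G) (a : BoundaryAlgebra K) : QuantumDouble G := fun h g =>
  if hg : ConjAct.ofConjAct g ∈ K then a (h : G ⧸ K) ⟨ConjAct.ofConjAct g, hg⟩ else 0

theorem boundaryExtend_pos {K : Subgroup G} (a : BoundaryAlgebra K) (h : G) {g : ConjAct G}
    (hg : ConjAct.ofConjAct g ∈ K) :
    boundaryExtend K a h g = a (h : G ⧸ K) ⟨ConjAct.ofConjAct g, hg⟩ := dif_pos hg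

theorem boundaryExtend_neg {K : Subgroup G} (a : BoundaryAlgebra K) (h : G) {g : ConjAct G}
    (hg : ConjAct.ofConjAct g ∉ K) : boundaryExtend K a h g = 0 := dif_neg hg

/-- The inclusion `Z(G,1,K,1) → D(G)`, sending `B^{hK} A^k` to `(∑_{j ∈ hK} B^j) A^k`. -/
def boundaryInclusion [Finite G] (K : Subgroup G) : BoundaryAlgebra K →ₐ[ℂ] QuantumDouble G :=
  AlgHom.ofLinearMap
    { toFun := boundaryExtend K
      map_add' := fun a b => by
        ext h g
        by_cases hg : ConjAct.ofConjAct g ∈ K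
        · simp [boundaryExtend_pos, hg]
        · simp [boundaryExtend_neg, hg]
      map_smul' := fun r a => by
        ext h g
        by_cases hg : ConjAct.ofConjAct g ∈ K
        · simp [boundaryExtend_pos, hg]
        · simp [boundaryExtend_neg, hg] }
    (by
      ext h g
      change boundaryExtend K 1 h g = _
      by_cases hg : ConjAct.ofConjAct g ∈ K
      · rw [boundaryExtend_pos _ _ hg, one_apply, one_apply]
        have : (⟨ConjAct.ofConjAct g, hg⟩ : K) = 1 ↔ g = 1 := by
          rw [Subtype.ext_iff]
          exact ConjAct.ofConjAct.map_eq_one_iff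
        simp only [this]
      · have : g ≠ 1 := by
          rintro rfl
          exact hg (by simp [K.one_mem])
        simp [boundaryExtend_neg _ _ hg, one_apply, this])
    (fun a b => by
      have := Fintype.ofFinite G
      have := Fintype.ofFinite (ConjAct G)
      have := Fintype.ofFinite K
      ext h g
      change boundaryExtend K (a * b) h g = (boundaryExtend K a * boundaryExtend K b) h g
      rw [mul_apply, finsum_eq_sum_of_fintype]
      let e : K → ConjAct G := fun k => ConjAct.toConjAct (k : G)
      have he : Function.Injective e := fun k k' hk => Subtype.ext (ConjAct.toConjAct.injective hk)
      have hsum : ∀ f : ConjAct G → ℂ, (∀ j, ConjAct.ofConjAct j ∉ K → f j = 0) →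
          ∑ j, f j = ∑ k, f (e k) := by
        intro f hf
        rw [← Finset.sum_image (s := Finset.univ) (g := e) (f := f) (fun _ _ _ _ h => he h)]
        refine (Finset.sum_subset (Finset.subset_univ _) fun j _ hj => hf j fun hjK => hj ?_).symm
        exact Finset.mem_image.mpr ⟨⟨ConjAct.ofConjAct j, hjK⟩, Finset.mem_univ _, rfl⟩
      rw [hsum _ (fun j hj => by rw [boundaryExtend_neg _ _ hj, zero_mul])]
      by_cases hg : ConjAct.ofConjAct g ∈ K
      · rw [boundaryExtend_pos _ _ hg, mul_apply, finsum_eq_sum_of_fintype]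
        refine Finset.sum_congr rfl fun k _ => ?_
        have h1 : ConjAct.ofConjAct (e k) ∈ K := k.2
        have h2 : ConjAct.ofConjAct ((e k)⁻¹ * g) ∈ K := by
          simpa [e] using K.mul_mem (K.inv_mem k.2) hg
        rw [boundaryExtend_pos _ _ h1, boundaryExtend_pos _ _ h2]
        have h3 : (((e k)⁻¹ • h : G) : G ⧸ K) = k⁻¹ • (h : G ⧸ K) := by
          change _ = (((k : G)⁻¹ * h : G) : G ⧸ K)
          rw [QuotientGroup.eq]
          simp [e, ConjAct.smul_def, mul_assoc]
        rw [h3]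
        rfl
      · rw [boundaryExtend_neg _ _ hg]
        refine (Finset.sum_eq_zero fun k _ => ?_).symm
        have h2 : ConjAct.ofConjAct ((e k)⁻¹ * g) ∉ K := by
          intro h
          apply hg
          have := K.mul_mem k.2 h
          simpa [e] using this
        rw [boundaryExtend_neg _ _ h2, mul_zero])

theorem boundaryInclusion_opZ [Finite G] {K : Subgroup G} (h : G) (k : K) :
    boundaryInclusion K (opZ h k) =
      ∑ᶠ (j : G) (_ : (j : G ⧸ K) = (h : G ⧸ K)), opD j (k : G) := by
  have := Fintype.ofFinite G
  have hfun : ∀ (f : G → QuantumDouble G) (x : G) (g : ConjAct G),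
      (∑ j, f j) x g = ∑ j, f j x g := fun f x g => by
    exact map_sum (coord x g) f Finset.univ
  rw [finsum_eq_sum_of_fintype]
  ext x g
  rw [hfun, Finset.sum_eq_single x]
  · change (if hg : ConjAct.ofConjAct g ∈ K then
      opZ h k (x : G ⧸ K) ⟨ConjAct.ofConjAct g, hg⟩ else 0) = _
    by_cases hx : (x : G ⧸ K) = (h : G ⧸ K)
    · by_cases hg : ConjAct.ofConjAct g ∈ K
      · simp only [hg, hx, finsum_true, opZ, opD, single, dite_true, true_and, Subtype.ext_iff]
        rfl
      · have : g ≠ ConjAct.toConjAct (k : G) := by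
          rintro rfl
          exact hg k.2
        simp [hg, hx, opD, single, this]
    · simp [hx, opZ, single]
  · intro j _ hj
    by_cases hjh : (j : G ⧸ K) = (h : G ⧸ K)
    · simp [hjh, opD, single, hj.symm]
    · simp [hjh]
  · simp

/-! ### Bulk and boundary excitations -/

/-- The centralizer `E(C)`, for the conjugacy class `C` of `c`. -/
abbrev centr (c : G) : Subgroup G := Subgroup.centralizer {c}

/-- `E(C)` inside the group `G` acting on itself by conjugation. -/
def centrHom (c : G) : centr c →* ConjAct G :=
  (ConjAct.toConjAct (G := G)).toMonoidHom.comp (centr c).subtype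

theorem centrHom_smul (c : G) (s : centr c) : centrHom c s • c = c := by
  change (s : G) * c * (s : G)⁻¹ = c
  rw [mul_inv_eq_iff_eq_mul]
  exact Subgroup.mem_centralizer_singleton_iff.mp s.2

/-- The stabilizer `K^r = K ∩ r K r⁻¹`. -/
def stab (K : Subgroup G) (r : G) : Subgroup G := K ⊓ K.map (MulAut.conj r).toMonoidHom

/-- The inclusion of `K^r` in `K`. -/
def stabHom (K : Subgroup G) (r : G) : stab K r →* K := Subgroup.inclusion inf_le_left

theorem stabHom_smul (K : Subgroup G) (r : G) (s : stab K r) :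
    stabHom K r s • (r : G ⧸ K) = (r : G ⧸ K) := by
  change (((s : G) * r : G) : G ⧸ K) = (r : G ⧸ K)
  obtain ⟨k, hk, hks⟩ := s.2.2
  rw [eq_comm, QuotientGroup.eq, ← hks]
  simpa [mul_assoc] using hk

variable [Finite G] {d : ℕ}

/-- The space of the irreducible representation of `D(G)` attached to `(C, π)`. -/
abbrev bulkSpace (c : G) (π : Representation ℂ (centr c) (Fin d → ℂ)) :
    Submodule ℂ (ConjAct G → Fin d → ℂ) := indSpace (centrHom c) π

/-- The irreducible representation of `D(G)` attached to the bulk excitation `(C, π)`. -/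
def bulkRep (c : G) (π : Representation ℂ (centr c) (Fin d → ℂ)) :
    QuantumDouble G →ₐ[ℂ] Module.End ℂ (bulkSpace c π) :=
  indRep (centrHom c) π c (centrHom_smul c)

/-- The space of the irreducible representation of `Z(G,1,K,1)` attached to `(T, R)`. -/
abbrev boundarySpace (K : Subgroup G) (r : G) (R : Representation ℂ (stab K r) (Fin d → ℂ)) :
    Submodule ℂ (K → Fin d → ℂ) := indSpace (stabHom K r) R

/-- The irreducible representation of `Z(G,1,K,1)` attached to the boundary excitation `(T, R)`,
where `T = K r K`. -/
def boundaryRep (K : Subgroup G) (r : G) (R : Representation ℂ (stab K r) (Fin d → ℂ)) :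
    BoundaryAlgebra K →ₐ[ℂ] Module.End ℂ (boundarySpace K r R) :=
  indRep (stabHom K r) R (r : G ⧸ K) (stabHom_smul K r)

/-- Quantum dimension `|C| dim π` of a bulk excitation. -/
def bulkFPdim (c : G) (d : ℕ) : ℚ := Nat.card {g : G // IsConj c g} * d

/-- Quantum dimension `|K| dim R / |K^r|` of a boundary excitation. -/
def boundaryFPdim (K : Subgroup G) (r : G) (d : ℕ) : ℚ :=
  (Nat.card K : ℚ) / Nat.card (stab K r) * d

/-! ### Ribbon operators -/

/-- The ribbon operator `F^{(h,g)}`: the ribbon operators form the dual of `D(G)`, and the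
`F^{(h,g)}` are the basis dual to the `D^{(h,g)}`. -/
def opF (h g : G) : Module.Dual ℂ (QuantumDouble G) := coord h (ConjAct.toConjAct g)

/-- The boundary ribbon operator `Y^{(hK,k)}`: the boundary ribbon operators form the dual of
`Z(G,1,K,1)`, and the `Y^{(hK,k)}` are the basis dual to the `Z^{(hK,k)}`. -/
def opY {K : Subgroup G} (h : G) (k : K) : Module.Dual ℂ (BoundaryAlgebra K) :=
  coord (h : G ⧸ K) k

/-- Pushing a ribbon operator into the boundary: restriction from `D(G)` to `Z(G,1,K,1)`. -/
def condense (K : Subgroup G) :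
    Module.Dual ℂ (QuantumDouble G) →ₗ[ℂ] Module.Dual ℂ (BoundaryAlgebra K) :=
  (boundaryInclusion K).toLinearMap.dualMap

theorem condense_opF (K : Subgroup G) (h g : G) :
    condense K (opF h g) = if hg : g ∈ K then opY h ⟨g, hg⟩ else 0 := by
  apply LinearMap.ext
  intro a
  change (if hg : g ∈ K then a (h : G ⧸ K) ⟨g, hg⟩ else 0) = _
  by_cases hg : g ∈ K
  · simp only [hg, dite_true]
    rfl
  · simp [hg]

/-- The ribbon operator
`F^{(C,π);(u,v)} = dim π / |E(C)| ∑_k (Γ_π(k)⁻¹)_{jj'} F^{(c_i, p_i k p_{i'}⁻¹)}`,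
`u = (i, j)`, `v = (i', j')`, where `c_i = p_i c p_i⁻¹`
and the `p_i` are representatives of `G/E(C)`. -/
def ribbonF (c : G) (π : Representation ℂ (centr c) (Fin d → ℂ)) (p : G ⧸ centr c → G)
    (u v : (G ⧸ centr c) × Fin d) : Module.Dual ℂ (QuantumDouble G) :=
  ((d : ℂ) / Nat.card (centr c)) •
    ∑ᶠ k : centr c, (LinearMap.toMatrix' (π k))⁻¹ u.2 v.2 •
      opF (p u.1 * c * (p u.1)⁻¹) (p u.1 * (k : G) * (p v.1)⁻¹)

/-- The boundary ribbon operator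
`Y^{(T,R);(u,v)} = dim R / |K^r| ∑_k (Γ_R(k)⁻¹)_{jj'} Y^{(s_i K, q_i k q_{i'}⁻¹)}`,
`u = (i, j)`, `v = (i', j')`, where `s_i = q_i r q_i⁻¹`
and the `q_i` are representatives of `K/K^r`. -/
def ribbonY (K : Subgroup G) (r : G) (R : Representation ℂ (stab K r) (Fin d → ℂ))
    (q : K ⧸ (stab K r).subgroupOf K → K)
    (u v : (K ⧸ (stab K r).subgroupOf K) × Fin d) : Module.Dual ℂ (BoundaryAlgebra K) :=
  ((d : ℂ) / Nat.card (stab K r)) •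
    ∑ᶠ k : stab K r, (LinearMap.toMatrix' (R k))⁻¹ u.2 v.2 •
      opY ((q u.1 : G) * r * (q u.1 : G)⁻¹) (q u.1 * stabHom K r k * (q v.1)⁻¹)

end Bulk

/-! ### Irreducible representations and multiplicities -/

/-- A complete set of representatives of the irreducible complex representations of a finite
group, each written in a basis. -/
structure IrrepSystem (S : Type*) [Group S] where
  /-- The set of labels. -/
  idx : Type
  finite_idx : Finite idx
  /-- The dimensions. -/
  dim : idx → ℕ
  /-- The representations. -/
  rep : ∀ i, Representation ℂ S (Fin (dim i) → ℂ)
  irreducible_rep : ∀ i, (rep i).IsIrreducible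
  distinct : ∀ i j, Nonempty ((rep i).Equiv (rep j)) → i = j
  complete : ∀ (d : ℕ) (ρ : Representation ℂ S (Fin d → ℂ)), ρ.IsIrreducible →
    ∃ i, Nonempty (ρ.Equiv (rep i))

/-- The multiplicity `n^ρ_σ = dim Hom_S(σ, ρ)` of the irreducible representation `σ` in `ρ`. -/
def repMultiplicity {S V W : Type*} [Group S] [AddCommGroup V] [Module ℂ V] [AddCommGroup W]
    [Module ℂ W] (σ : Representation ℂ S V) (ρ : Representation ℂ S W) : ℕ :=
  Module.finrank ℂ (σ.IntertwiningMap ρ)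

section Mackey

variable {G : Type*} [Group G] {d : ℕ}

/-- The conjugate `x E(C) x⁻¹`. -/
def conjCentr (c x : G) : Subgroup G := (centr c).map (MulAut.conj x).toMonoidHom

/-- The isomorphism `y ↦ x⁻¹ y x` from `x E(C) x⁻¹` to `E(C)`. -/
def conjCentrHom (c x : G) : conjCentr c x →* centr c :=
  (((MulAut.conj x⁻¹).toMonoidHom.comp (conjCentr c x).subtype)).codRestrict (centr c) (by
    rintro ⟨_, e, he, rfl⟩
    simpa [mul_assoc] using he)

theorem conjCentrHom_apply (c x : G) (y : conjCentr c x) :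
    (conjCentrHom c x y : G) = x⁻¹ * y * x := by
  simp [conjCentrHom]

/-- The representation `x ▷ π` of `x E(C) x⁻¹`. -/
def conjRep (c x : G) (π : Representation ℂ (centr c) (Fin d → ℂ)) :
    Representation ℂ (conjCentr c x) (Fin d → ℂ) := π.comp (conjCentrHom c x)

/-- The subgroup `x E(C) x⁻¹ ∩ K^r`. -/
def interGroup (K : Subgroup G) (r c x : G) : Subgroup G := conjCentr c x ⊓ stab K r

/-- The restriction of `x ▷ π` to `x E(C) x⁻¹ ∩ K^r`. -/
def restrictBulk (K : Subgroup G) (r c x : G) (π : Representation ℂ (centr c) (Fin d → ℂ)) :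
    Representation ℂ (interGroup K r c x) (Fin d → ℂ) :=
  (conjRep c x π).comp (Subgroup.inclusion inf_le_left)

/-- The restriction of `R` to `x E(C) x⁻¹ ∩ K^r`. -/
def restrictBoundary (K : Subgroup G) (r c x : G)
    (R : Representation ℂ (stab K r) (Fin d → ℂ)) :
    Representation ℂ (interGroup K r c x) (Fin d → ℂ) :=
  R.comp (Subgroup.inclusion inf_le_right)

/-- The sum `∑ n^R_σ n^{x ▷ π}_σ` over the `x ∈ X` with `x c x⁻¹ ∈ T = K r K` and over the
irreducible representations `σ` of `x E(C) x⁻¹ ∩ K^r`. -/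
def condensationNumber (K : Subgroup G) (r c : G) (π : Representation ℂ (centr c) (Fin d → ℂ))
    {e : ℕ} (R : Representation ℂ (stab K r) (Fin e → ℂ)) (X : Set G)
    (irrInter : ∀ x, IrrepSystem (interGroup K r c x)) : ℕ :=
  ∑ᶠ (x : G) (_ : x ∈ X ∧ x * c * x⁻¹ ∈ DoubleCoset.doubleCoset r (K : Set G) K),
    ∑ᶠ σ : (irrInter x).idx,
      repMultiplicity ((irrInter x).rep σ) (restrictBoundary K r c x R) *
        repMultiplicity ((irrInter x).rep σ) (restrictBulk K r c x π)

/-- The restriction of `(C, π)` to `Z(G,1,K,1)` is isomorphic to the direct sum of `n T i` copies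
of the boundary excitations `(T, R_{T,i})`. -/
def DecomposesWith [Finite G] (K : Subgroup G) (r : DoubleCoset.Quotient (K : Set G) K → G)
    (irr : ∀ T, IrrepSystem (stab K (r T))) (c : G)
    (π : Representation ℂ (centr c) (Fin d → ℂ)) (n : ∀ T, (irr T).idx → ℕ) : Prop :=
  ∃ e : bulkSpace c π ≃ₗ[ℂ]
      (∀ T, ∀ i : (irr T).idx, Fin (n T i) → boundarySpace K (r T) ((irr T).rep i)),
    ∀ (z : BoundaryAlgebra K) (f : bulkSpace c π) (T) (i : (irr T).idx) (m : Fin (n T i)),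
      e (bulkRep c π (boundaryInclusion K z) f) T i m =
        boundaryRep K (r T) ((irr T).rep i) z (e f T i m)

/-- The index set of the bulk local degrees of freedom `(i, j)`. -/
abbrev BulkIdx (c : G) (d : ℕ) : Type _ := (G ⧸ centr c) × Fin d

/-- The index set of the boundary local degrees of freedom `(i, j)`. -/
abbrev BoundaryIdx (K : Subgroup G) (r : G) (e : ℕ) : Type _ :=
  (K ⧸ (stab K r).subgroupOf K) × Fin e

/-- The `a u₁ v₁ T i u₂ v₂` are the coefficients of an expansion of the operators
`F^{(C,π);(u₁,v₁)}`, pushed into the boundary, in the operators `Y^{(T,R_{T,i});(u₂,v₂)}`. -/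
def IsExpansion [Finite G] (K : Subgroup G) (r : DoubleCoset.Quotient (K : Set G) K → G)
    (irr : ∀ T, IrrepSystem (stab K (r T))) (q : ∀ T, K ⧸ (stab K (r T)).subgroupOf K → K)
    (c : G) (π : Representation ℂ (centr c) (Fin d → ℂ)) (p : G ⧸ centr c → G)
    (a : BulkIdx c d → BulkIdx c d → ∀ T, ∀ i : (irr T).idx,
      BoundaryIdx K (r T) ((irr T).dim i) → BoundaryIdx K (r T) ((irr T).dim i) → ℂ) : Prop :=
  ∀ u₁ v₁, condense K (ribbonF c π p u₁ v₁) =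
    ∑ᶠ T, ∑ᶠ i, ∑ᶠ u₂, ∑ᶠ v₂,
      a u₁ v₁ T i u₂ v₂ • ribbonY K (r T) ((irr T).rep i) (q T) u₂ v₂

end Mackey

end

/-! `ActionAlgebra X H` is the algebra of the action groupoid of `H` on `X`. A module over it is an
`X`-graded vector space on which `H` permutes the degrees, so it is determined by one representation
of a stabilizer for each orbit, namely the part in the degree of a chosen point. For the boundary
algebra `X` is `G ⧸ K` and the group is `K`. The orbits are the double cosets `T`, the stabilizer of
the coset of `r T` is `stab K (r T)`, and the boundary excitation `(T, R)` corresponds to `R` placed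
on the orbit `T`. `decomposesInto_fiberRep` and `exists_linearEquiv_of_decomposesInto_fiberRep` make
this precise: decomposing `(C, π)` over the boundary algebra amounts to decomposing, for every `T`,
its part in degree `r T` as a representation of `stab K (r T)`.

That part consists of the functions in the bulk space supported on the `g` with `g c g⁻¹ ∈ r K`.
This set is a union of double cosets of `stab K r` and `E(C)`, which are indexed by the `x ∈ X` with
`x c x⁻¹ ∈ T`. Frobenius reciprocity and Mackey's argument, in `repMultiplicity_bulkFiberRep`,
identify the intertwining maps from `R` into it with families, over these `x`, of intertwining maps
from `R` to `x ▷ π` on `x E(C) x⁻¹ ∩ K^r`. By Schur's lemma (`repMultiplicity_eq_sum`) each such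
space has dimension `∑ n^R_σ n^{x ▷ π}_σ`, which gives (b). Taking dimensions in the decomposition
gives (c).

For (a), the boundary ribbon operators on an orbit are normalized matrix coefficients of the
stabilizer. Schur orthogonality (`ribbonY_boundaryDual_self`) and Fourier inversion
(`eq_sum_ribbonY`) make them a basis of the dual, so a coefficient is the value on a dual element
`boundaryDual`. For the image of a bulk ribbon operator this value is, up to a nonzero factor, an
entry of a linear map averaged over `stab K r` and `E(C)` (`condense_ribbonF_boundaryDual`). Such
averages produce all the intertwining maps counted in (b), so some coefficient is nonzero exactly
when some `x` carries a nonzero one. -/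

noncomputable section

open scoped Classical

set_option linter.unusedSectionVars false

/-! ### Equivalences and averaging for group representations -/

namespace Representation

open scoped MonoidAlgebra

variable {k S V W U : Type*} [Field k] [Group S] [AddCommGroup V] [Module k V]
  [AddCommGroup W] [Module k W] [AddCommGroup U] [Module k U]

/-- Equivalent representations have isomorphic modules over the group algebra. -/
def Equiv.asModuleEquiv {ρ : Representation k S V} {σ : Representation k S W} (e : ρ.Equiv σ) :
    ρ.asModule ≃ₗ[k[S]] σ.asModule :=
  LinearEquiv.ofBijective (IntertwiningMap.equivLinearMapAsModule ρ σ e.toIntertwiningMap)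
    e.toLinearEquiv.bijective

theorem IsIrreducible.of_equiv {ρ : Representation k S V} {σ : Representation k S W}
    (e : ρ.Equiv σ) (h : ρ.IsIrreducible) : σ.IsIrreducible := by
  rw [irreducible_iff_isSimpleModule_asModule] at h ⊢
  exact IsSimpleModule.congr e.asModuleEquiv.symm

/-- Transport of a representation along a linear equivalence. -/
def transport (ρ : Representation k S V) (e : V ≃ₗ[k] W) : Representation k S W where
  toFun s := e.toLinearMap ∘ₗ ρ s ∘ₗ e.symm.toLinearMap
  map_one' := by ext; simp
  map_mul' s t := by ext; simp

/-- A representation is equivalent to its transport. -/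
def equivTransport (ρ : Representation k S V) (e : V ≃ₗ[k] W) : ρ.Equiv (ρ.transport e) :=
  Equiv.mk e fun s => by ext; simp [transport]

/-- Precomposition and postcomposition with equivalences. -/
def intertwiningMapCongr {V' W' : Type*} [AddCommGroup V'] [Module k V'] [AddCommGroup W']
    [Module k W'] {ρ : Representation k S V} {σ : Representation k S W}
    {ρ' : Representation k S V'} {σ' : Representation k S W'} (e : ρ.Equiv ρ') (f : σ.Equiv σ') :
    ρ.IntertwiningMap σ ≃ₗ[k] ρ'.IntertwiningMap σ' where
  toFun φ := (f.toIntertwiningMap.comp φ).comp e.symm.toIntertwiningMap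
  invFun φ := (f.symm.toIntertwiningMap.comp φ).comp e.toIntertwiningMap
  map_add' φ ψ := by ext; simp
  map_smul' r φ := by ext; simp
  left_inv φ := by ext; simp
  right_inv φ := by ext; simp

/-- Sum over the group of the conjugates of a linear map. -/
def sumConj [Finite S] (ρ : Representation k S V) (σ : Representation k S W) (M : V →ₗ[k] W) :
    ρ.IntertwiningMap σ where
  toLinearMap := ∑ᶠ s : S, σ s ∘ₗ M ∘ₗ ρ s⁻¹
  isIntertwining' t := by
    have := Fintype.ofFinite S
    ext v
    simp only [finsum_eq_sum_of_fintype, LinearMap.comp_apply, LinearMap.sum_apply, map_sum]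
    rw [← _root_.Equiv.sum_comp (_root_.Equiv.mulLeft t)]
    simp

theorem sumConj_apply [Fintype S] (ρ : Representation k S V) (σ : Representation k S W)
    (M : V →ₗ[k] W) (v : V) : sumConj ρ σ M v = ∑ s : S, σ s (M (ρ s⁻¹ v)) := by
  change (∑ᶠ s : S, σ s ∘ₗ M ∘ₗ ρ s⁻¹) v = _
  simp [finsum_eq_sum_of_fintype]

end Representation

open Representation ActionAlgebra

/-! ### Complete reducibility -/

namespace IrrepSystem

variable {S : Type*} [Group S] [Finite S] (irr : IrrepSystem S)
  {V W : Type*} [AddCommGroup V] [Module ℂ V] [AddCommGroup W] [Module ℂ W]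

instance : Finite irr.idx := irr.finite_idx

instance : Fintype irr.idx := Fintype.ofFinite _

instance (i : irr.idx) : (irr.rep i).IsIrreducible := irr.irreducible_rep i

theorem exists_equiv [FiniteDimensional ℂ V] (ρ : Representation ℂ S V) (h : ρ.IsIrreducible) :
    ∃ i, Nonempty (ρ.Equiv (irr.rep i)) := by
  let e := (Module.finBasis ℂ V).equivFun
  obtain ⟨i, ⟨f⟩⟩ := irr.complete _ (ρ.transport e) (h.of_equiv (ρ.equivTransport e))
  exact ⟨i, ⟨(ρ.equivTransport e).trans f⟩⟩

/-- The representation `ρ` is the direct sum of `n i` copies of each irreducible representation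
of the system. -/
def DecomposesInto (ρ : Representation ℂ S V) (n : irr.idx → ℕ) : Prop :=
  ∃ e : V ≃ₗ[ℂ] (∀ i, Fin (n i) → Fin (irr.dim i) → ℂ),
    ∀ s v i m, e (ρ s v) i m = irr.rep i s (e v i m)

-- Maschke's theorem makes the group algebra semisimple, so the module is a finite direct sum of
-- simple submodules, and completeness of the system labels each of them.
open scoped MonoidAlgebra in
theorem exists_linearEquiv_pi [FiniteDimensional ℂ V] (ρ : Representation ℂ S V) :
    ∃ (N : ℕ) (t : Fin N → irr.idx) (e : V ≃ₗ[ℂ] (∀ j, Fin (irr.dim (t j)) → ℂ)),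
      ∀ s v j, e (ρ s v) j = irr.rep (t j) s (e v j) := by
  have : IsNoetherian ℂ[S] ρ.asModule := isNoetherian_of_tower ℂ inferInstance
  obtain ⟨N, A, e, hA⟩ := IsSemisimpleModule.exists_linearEquiv_fin_dfinsupp ℂ[S] ρ.asModule
  have key : ∀ j, ∃ i, Nonempty (A j ≃ₗ[ℂ[S]] (irr.rep i).asModule) := by
    intro j
    -- The simple summand is a subrepresentation with a group algebra action of its own. This action
    -- agrees with the inherited one, as is seen on the elements `single g a`.
    let B := Subrepresentation.ofSubmodule' (ρ := ρ) (A j)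
    let u : B.toRepresentation.asModule → ρ.asModule := fun v => Subtype.val (p := (· ∈ A j)) v
    have hu : ∀ (a : ℂ[S]) v, u (a • v) = a • u v := by
      intro a v
      induction a using MonoidAlgebra.induction_linear with
      | zero => rw [zero_smul, zero_smul]; rfl
      | add x y hx hy => rw [add_smul, add_smul, ← hx, ← hy]; rfl
      | single g a =>
        rw [Representation.single_smul, Representation.single_smul]
        rfl
    let f : B.toRepresentation.asModule ≃ₗ[ℂ[S]] A j :=
      { toFun := fun v => v
        invFun := fun v => v
        map_add' := fun _ _ => rfl
        map_smul' := fun a v => Subtype.ext (hu a v)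
        left_inv := fun _ => rfl
        right_inv := fun _ => rfl }
    have := hA j
    have : B.toRepresentation.IsIrreducible := by
      rw [irreducible_iff_isSimpleModule_asModule]
      exact IsSimpleModule.congr f
    obtain ⟨i, ⟨h⟩⟩ := irr.exists_equiv _ this
    exact ⟨i, ⟨f.symm.trans h.asModuleEquiv⟩⟩
  choose t ht using key
  let E : ρ.asModule ≃ₗ[ℂ[S]] (∀ j, (irr.rep (t j)).asModule) :=
    (e.trans (DFinsupp.linearEquivFunOnFintype)).trans
      (LinearEquiv.piCongrRight fun j => (ht j).some)
  have hE : ∀ (a : ℂ) v, E (a • v) = a • E v := by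
    intro a v
    rw [← algebraMap_smul ℂ[S] a v, map_smul]
    ext j : 1
    simp only [Pi.smul_apply, algebraMap_smul]
  refine ⟨N, t,
    { toFun := fun v => E v
      invFun := fun v => E.symm v
      map_add' := fun v w => E.map_add v w
      map_smul' := hE
      left_inv := E.left_inv
      right_inv := E.right_inv }, ?_⟩
  intro s v j
  have h1 := congrFun (E.map_smul (MonoidAlgebra.single s 1) (ρ.asModuleEquiv.symm v)) j
  rw [Pi.smul_apply] at h1
  erw [Representation.single_smul, Representation.single_smul, one_smul, one_smul] at h1
  exact h1

/-- Two equal labels have the same space. -/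
def spaceCongr {i j : irr.idx} (h : i = j) : (Fin (irr.dim i) → ℂ) ≃ₗ[ℂ] (Fin (irr.dim j) → ℂ) :=
  h ▸ LinearEquiv.refl ℂ _

theorem spaceCongr_rep {i j : irr.idx} (h : i = j) (s : S) (v : Fin (irr.dim i) → ℂ) :
    irr.spaceCongr h (irr.rep i s v) = irr.rep j s (irr.spaceCongr h v) := by
  subst h; rfl

/-- The summands are collected by label: `n i` is the number of summands labelled `i`, and
`spaceCongr` moves a summand along the equality of labels. -/
theorem exists_decomposesInto [FiniteDimensional ℂ V] (ρ : Representation ℂ S V) :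
    ∃ n, irr.DecomposesInto ρ n := by
  obtain ⟨N, t, e, he⟩ := irr.exists_linearEquiv_pi ρ
  let n : irr.idx → ℕ := fun i => Fintype.card {j // t j = i}
  let f : ∀ i, Fin (n i) ≃ {j // t j = i} := fun i => (Fintype.equivFin _).symm
  let g : V →ₗ[ℂ] (∀ i, {j // t j = i} → Fin (irr.dim i) → ℂ) :=
    { toFun := fun v i m => irr.spaceCongr m.2 (e v m.1)
      map_add' := fun v w => by ext; simp
      map_smul' := fun a v => by ext; simp }
  refine ⟨n, LinearEquiv.ofBijective
    { toFun := fun v i m => g v i (f i m)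
      map_add' := fun v w => by ext; simp
      map_smul' := fun a v => by ext; simp } ⟨?_, ?_⟩, ?_⟩
  · intro v w h
    apply e.injective
    ext j : 1
    have := congrFun (congrFun h (t j)) ((f (t j)).symm ⟨j, rfl⟩)
    simp only [LinearMap.coe_mk, AddHom.coe_mk, Equiv.apply_symm_apply] at this
    exact this
  · intro w
    let v := e.symm fun j => w (t j) ((f (t j)).symm ⟨j, rfl⟩)
    have hv : ∀ i p, g v i p = w i ((f i).symm p) := by
      rintro i ⟨j, rfl⟩
      change e v j = _
      simp [v]
    refine ⟨v, ?_⟩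
    ext i m : 2
    simp [hv]
  · intro s v i m
    change irr.spaceCongr _ (e (ρ s v) _) = irr.rep i s (irr.spaceCongr _ (e v _))
    rw [he, spaceCongr_rep]

end IrrepSystem

/-! ### Schur's lemma and multiplicities -/

namespace IrrepSystem

variable {S : Type*} [Group S] [Finite S] (irr : IrrepSystem S)
  {V W : Type*} [AddCommGroup V] [Module ℂ V] [AddCommGroup W] [Module ℂ W]

theorem repMultiplicity_rep_rep (i j : irr.idx) :
    repMultiplicity (irr.rep i) (irr.rep j) = if i = j then 1 else 0 := by
  split_ifs with h
  · subst h
    exact IsIrreducible.finrank_intertwiningMap_self _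
  · have : IsEmpty ((irr.rep i).Equiv (irr.rep j)) := ⟨fun e => h (irr.distinct i j ⟨e⟩)⟩
    exact Module.finrank_zero_of_subsingleton

namespace DecomposesInto

variable {irr} {ρ : Representation ℂ S V} {n : irr.idx → ℕ}

theorem repMultiplicity_right (h : irr.DecomposesInto ρ n) [FiniteDimensional ℂ W]
    (τ : Representation ℂ S W) :
    repMultiplicity τ ρ = ∑ i, n i * repMultiplicity τ (irr.rep i) := by
  obtain ⟨e, he⟩ := h
  let E : τ.IntertwiningMap ρ ≃ₗ[ℂ] (∀ i, Fin (n i) → τ.IntertwiningMap (irr.rep i)) :=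
    { toFun := fun φ i m =>
        { toFun := fun w => e (φ w) i m
          map_add' := fun v w => by simp
          map_smul' := fun a v => by simp
          isIntertwining' := fun s => by
            ext w : 1
            simp [φ.isIntertwining, he] }
      invFun := fun ψ =>
        { toFun := fun w => e.symm fun i m => ψ i m w
          map_add' := fun v w => by rw [← map_add]; congr 1; ext; simp
          map_smul' := fun a v => by rw [← map_smul]; congr 1; ext; simp
          isIntertwining' := fun s => by
            ext w : 1
            apply e.injective
            ext i m : 2
            simp [IntertwiningMap.isIntertwining, he] }
      map_add' := fun φ ψ => by
        ext i m w : 4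
        exact congrFun (congrFun (map_add e (φ w) (ψ w)) i) m
      map_smul' := fun a φ => by
        ext i m w : 4
        exact congrFun (congrFun (map_smul e a (φ w)) i) m
      left_inv := fun φ => by
        ext w : 2
        exact e.symm_apply_apply _
      right_inv := fun ψ => by
        ext i m w : 4
        exact congrFun (congrFun (e.apply_symm_apply _) i) m }
  rw [repMultiplicity, E.finrank_eq, Module.finrank_pi_fintype]
  simp [Module.finrank_pi_fintype, repMultiplicity]

/-- A map out of a direct sum is a family of maps out of the summands, obtained by composing with
the inclusions `ι i m`. -/
theorem repMultiplicity_left (h : irr.DecomposesInto ρ n) [FiniteDimensional ℂ W]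
    (τ : Representation ℂ S W) :
    repMultiplicity ρ τ = ∑ i, n i * repMultiplicity (irr.rep i) τ := by
  obtain ⟨e, he⟩ := h
  let ι : ∀ i (m : Fin (n i)), (Fin (irr.dim i) → ℂ) →ₗ[ℂ] V := fun i m =>
    e.symm.toLinearMap ∘ₗ LinearMap.single ℂ (fun i => Fin (n i) → Fin (irr.dim i) → ℂ) i ∘ₗ
      LinearMap.single ℂ (fun _ : Fin (n i) => Fin (irr.dim i) → ℂ) m
  have hι : ∀ i m s v, ι i m (irr.rep i s v) = ρ s (ι i m v) := by
    intro i m s v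
    apply e.injective
    ext j l : 2
    rw [he]
    simp only [ι, LinearMap.comp_apply, LinearEquiv.coe_coe, LinearEquiv.apply_symm_apply,
      LinearMap.coe_single]
    by_cases hj : j = i
    · subst hj
      by_cases hl : l = m
      · subst hl; simp
      · simp [hl]
    · simp [hj]
  have hsum : ∀ v, ∑ i, ∑ m, ι i m (e v i m) = v := by
    intro v
    apply e.injective
    simp only [ι, map_sum, LinearMap.comp_apply, LinearEquiv.coe_coe, LinearEquiv.apply_symm_apply,
      LinearMap.coe_single]
    have hi : ∀ i, ∑ m, Pi.single (M := fun i => Fin (n i) → Fin (irr.dim i) → ℂ) i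
        (Pi.single m (e v i m)) = Pi.single i (e v i) := by
      intro i
      rw [← LinearMap.coe_single (R := ℂ), ← map_sum, Finset.univ_sum_single]
    simp only [hi, Finset.univ_sum_single]
  -- The components of the inclusions form an identity matrix; `spaceCongr` supplies the cast
  -- between the spaces of two labels known only to be equal.
  have hcomp : ∀ i m j l v, e (ι i m v) j l =
      if h : i = j then (if h ▸ m = l then irr.spaceCongr h v else 0) else 0 := by
    intro i m j l v
    simp only [ι, LinearMap.comp_apply, LinearEquiv.coe_coe, LinearEquiv.apply_symm_apply,
      LinearMap.coe_single]
    by_cases hj : i = j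
    · subst hj
      by_cases hl : m = l
      · subst hl; simp; rfl
      · simp [hl, Ne.symm hl]
    · simp [hj, Ne.symm hj]
  let E : ρ.IntertwiningMap τ ≃ₗ[ℂ] (∀ i, Fin (n i) → (irr.rep i).IntertwiningMap τ) :=
    { toFun := fun φ i m =>
        { toLinearMap := φ.toLinearMap ∘ₗ ι i m
          isIntertwining' := fun s => by
            refine LinearMap.ext fun w => ?_
            simp [φ.isIntertwining, hι] }
      invFun := fun ψ =>
        { toLinearMap := ∑ i, ∑ m, (ψ i m).toLinearMap ∘ₗ LinearMap.proj m ∘ₗ LinearMap.proj i ∘ₗ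
            e.toLinearMap
          isIntertwining' := fun s => by
            ext w
            simp [he, IntertwiningMap.isIntertwining] }
      map_add' := fun φ ψ => by
        ext i m : 2
        refine IntertwiningMap.ext (LinearMap.ext fun w => ?_)
        simp
      map_smul' := fun a φ => by
        ext i m : 2
        refine IntertwiningMap.ext (LinearMap.ext fun w => ?_)
        simp
      left_inv := fun φ => by
        refine IntertwiningMap.ext (LinearMap.ext fun w => ?_)
        simp only [LinearMap.sum_apply, LinearMap.comp_apply, IntertwiningMap.toLinearMap_apply]
        conv_rhs => rw [← hsum w]
        simp [map_sum]
      right_inv := fun ψ => by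
        ext i m : 2
        refine IntertwiningMap.ext (LinearMap.ext fun w => ?_)
        simp only [LinearMap.sum_apply, LinearMap.comp_apply, LinearMap.proj_apply,
          LinearEquiv.coe_coe, hcomp]
        rw [Finset.sum_eq_single i, Finset.sum_eq_single m]
        · simp; rfl
        · intro l _ hl
          simp [hl.symm]
        · simp
        · intro j _ hj
          simp [hj.symm]
        · simp }
  rw [repMultiplicity, E.finrank_eq, Module.finrank_pi_fintype]
  simp [Module.finrank_pi_fintype, repMultiplicity]

theorem repMultiplicity_rep_left (h : irr.DecomposesInto ρ n) (i : irr.idx) :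
    repMultiplicity (irr.rep i) ρ = n i := by
  simp [h.repMultiplicity_right, repMultiplicity_rep_rep]

end DecomposesInto

/-- Multiplicities can be read off as dimensions of spaces of intertwining maps, so the ones of any
existing decomposition are the only possible ones. -/
theorem decomposesInto_iff [FiniteDimensional ℂ V] {ρ : Representation ℂ S V} {n : irr.idx → ℕ} :
    irr.DecomposesInto ρ n ↔ ∀ i, n i = repMultiplicity (irr.rep i) ρ := by
  refine ⟨fun h i => (h.repMultiplicity_rep_left i).symm, fun h => ?_⟩
  obtain ⟨n', hn'⟩ := irr.exists_decomposesInto ρ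
  rwa [funext fun i => (h i).trans (hn'.repMultiplicity_rep_left i)]

theorem repMultiplicity_eq_sum [FiniteDimensional ℂ V] [FiniteDimensional ℂ W]
    (τ : Representation ℂ S W) (ρ : Representation ℂ S V) :
    repMultiplicity τ ρ =
      ∑ i, repMultiplicity (irr.rep i) τ * repMultiplicity (irr.rep i) ρ := by
  obtain ⟨n, hn⟩ := irr.exists_decomposesInto τ
  simp [hn.repMultiplicity_left, hn.repMultiplicity_rep_left]

end IrrepSystem

theorem repMultiplicity_congr_left {S V V' W : Type*} [Group S] [AddCommGroup V] [Module ℂ V]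
    [AddCommGroup V'] [Module ℂ V'] [AddCommGroup W] [Module ℂ W] {σ : Representation ℂ S V}
    {σ' : Representation ℂ S V'} (e : σ.Equiv σ') (ρ : Representation ℂ S W) :
    repMultiplicity σ ρ = repMultiplicity σ' ρ :=
  (intertwiningMapCongr e (Representation.Equiv.refl ρ)).finrank_eq

/-- Two representations have a nonzero intertwining map if and only if they share an irreducible
constituent. -/
theorem repMultiplicity_ne_zero_iff {S V W : Type*} [Group S] [Finite S] [AddCommGroup V]
    [Module ℂ V] [FiniteDimensional ℂ V] [AddCommGroup W] [Module ℂ W] [FiniteDimensional ℂ W]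
    (irr : IrrepSystem S) (τ : Representation ℂ S W) (ρ : Representation ℂ S V) :
    repMultiplicity τ ρ ≠ 0 ↔ ∃ (e : ℕ) (σ : Representation ℂ S (Fin e → ℂ)), σ.IsIrreducible ∧
      repMultiplicity σ ρ ≠ 0 ∧ repMultiplicity σ τ ≠ 0 := by
  rw [irr.repMultiplicity_eq_sum]
  constructor
  · intro h
    obtain ⟨i, -, hi⟩ := Finset.exists_ne_zero_of_sum_ne_zero h
    exact ⟨_, irr.rep i, irr.irreducible_rep i, right_ne_zero_of_mul hi, left_ne_zero_of_mul hi⟩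
  · rintro ⟨e, σ, hσ, h1, h2⟩
    obtain ⟨i, ⟨f⟩⟩ := irr.complete e σ hσ
    rw [repMultiplicity_congr_left f] at h1 h2
    intro h
    rw [Finset.sum_eq_zero_iff] at h
    exact mul_ne_zero h2 h1 (h i (Finset.mem_univ i))

theorem repMultiplicity_ne_zero {S V W : Type*} [Group S] [AddCommGroup V]
    [Module ℂ V] [FiniteDimensional ℂ V] [AddCommGroup W] [Module ℂ W] [FiniteDimensional ℂ W]
    {τ : Representation ℂ S W} {ρ : Representation ℂ S V} :
    repMultiplicity τ ρ ≠ 0 ↔ ∃ φ : τ.IntertwiningMap ρ, φ ≠ 0 := by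
  rw [repMultiplicity, Ne, Module.finrank_eq_zero_iff_of_free, not_subsingleton_iff_nontrivial,
    nontrivial_iff_exists_ne 0]

/-! ### Schur orthogonality and Fourier inversion -/

namespace IrrepSystem

variable {S : Type*} [Group S] [Fintype S] (irr : IrrepSystem S)

/-- The matrix of `s` in the irreducible representation `i`. -/
def matrix (i : irr.idx) (s : S) : Matrix (Fin (irr.dim i)) (Fin (irr.dim i)) ℂ :=
  LinearMap.toMatrix' (irr.rep i s)

theorem matrix_inv (i : irr.idx) (s : S) : (irr.matrix i s)⁻¹ = irr.matrix i s⁻¹ := by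
  apply Matrix.inv_eq_left_inv
  rw [matrix, matrix, ← LinearMap.toMatrix'_mul, ← map_mul]
  simp

theorem rep_apply (i : irr.idx) (s : S) (v : Fin (irr.dim i) → ℂ) (a : Fin (irr.dim i)) :
    irr.rep i s v a = ∑ b, irr.matrix i s a b * v b := by
  rw [← LinearMap.toMatrix'_mulVec]
  rfl

theorem dim_pos (i : irr.idx) : 0 < irr.dim i := by
  rw [Nat.pos_iff_ne_zero]
  intro h
  have h1 : Module.finrank ℂ (Fin (irr.dim i) → ℂ) = 0 := by simp [h]
  have : Subsingleton (Fin (irr.dim i) → ℂ) := Module.finrank_zero_iff.mp h1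
  have h2 := irr.repMultiplicity_rep_rep i i
  rw [if_pos rfl, repMultiplicity] at h2
  have : Subsingleton ((irr.rep i).IntertwiningMap (irr.rep i)) :=
    ⟨fun φ ψ => IntertwiningMap.ext (LinearMap.ext fun v => Subsingleton.elim _ _)⟩
  rw [Module.finrank_zero_of_subsingleton] at h2
  exact zero_ne_one h2

/-- Averaging the matrix unit at `(b, c)` produces an intertwining map, and the sum is one of its
entries. Schur's lemma then evaluates it. -/
theorem sum_matrix_mul_matrix_inv (i j : irr.idx) (a b : Fin (irr.dim j)) (c d : Fin (irr.dim i)) :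
    ∑ s, irr.matrix j s a b * irr.matrix i s⁻¹ c d =
      sumConj (irr.rep i) (irr.rep j) (Matrix.toLin' (Matrix.single b c 1)) (Pi.single d 1) a := by
  rw [sumConj_apply, Finset.sum_apply]
  refine Finset.sum_congr rfl fun s _ => ?_
  rw [rep_apply, Finset.sum_eq_single b]
  · simp [Matrix.toLin'_apply, Matrix.single_mulVec, rep_apply, Pi.single_apply, Function.update]
  · intro b' _ hb
    simp [Matrix.toLin'_apply, Matrix.single_mulVec, hb]
  · simp

theorem sum_matrix_mul_matrix_inv_of_ne {i j : irr.idx} (h : j ≠ i) (a b : Fin (irr.dim j))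
    (c d : Fin (irr.dim i)) : ∑ s, irr.matrix j s a b * irr.matrix i s⁻¹ c d = 0 := by
  have : IsEmpty ((irr.rep i).Equiv (irr.rep j)) := ⟨fun e => h (irr.distinct i j ⟨e⟩).symm⟩
  rw [sum_matrix_mul_matrix_inv, Subsingleton.elim (sumConj _ _ _) 0]
  rfl

theorem sum_matrix_mul_matrix_inv_self (i : irr.idx) (a b c d : Fin (irr.dim i)) :
    ∑ s, irr.matrix i s a b * irr.matrix i s⁻¹ c d =
      if a = d ∧ b = c then (Nat.card S : ℂ) / irr.dim i else 0 := by
  rw [sum_matrix_mul_matrix_inv]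
  -- The average is a scalar `z`. Comparing traces, `z` times the dimension equals the order of the
  -- group times the trace of the matrix unit.
  set φ := sumConj (irr.rep i) (irr.rep i) (Matrix.toLin' (Matrix.single b c 1)) with hφ
  obtain ⟨z, hz⟩ := IsIrreducible.algebraMap_intertwiningMap_bijective_of_isAlgClosed.2 φ
  have h1 : ∀ v, φ v = z • v := fun v => by rw [← hz]; simp
  have h2 : LinearMap.trace ℂ _ φ.toLinearMap = z * irr.dim i := by
    have : φ.toLinearMap = z • LinearMap.id := LinearMap.ext h1
    rw [this, map_smul, LinearMap.trace_id]
    simp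
  have h3 : LinearMap.trace ℂ _ φ.toLinearMap = Nat.card S * if b = c then 1 else 0 := by
    have : φ.toLinearMap = ∑ s : S, irr.rep i s ∘ₗ
        Matrix.toLin' (Matrix.single b c 1) ∘ₗ irr.rep i s⁻¹ := by
      refine LinearMap.ext fun v => ?_
      simp [hφ, sumConj_apply]
    rw [this, map_sum, Finset.sum_congr rfl (g := fun _ => if b = c then 1 else 0)]
    · simp
    · intro s _
      rw [LinearMap.trace_comp_comm', LinearMap.comp_assoc]
      have : irr.rep i s⁻¹ ∘ₗ irr.rep i s = LinearMap.id := by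
        change irr.rep i s⁻¹ * irr.rep i s = 1
        rw [← map_mul]; simp
      rw [this, LinearMap.comp_id, Matrix.trace_toLin'_eq]
      by_cases h : b = c
      · subst h; simp
      · simp [h]
  have hd : (irr.dim i : ℂ) ≠ 0 := Nat.cast_ne_zero.mpr (irr.dim_pos i).ne'
  have h4 : z = Nat.card S * (if b = c then 1 else 0) / irr.dim i := by
    rw [eq_div_iff hd, ← h2, h3]
  rw [h1, h4]
  by_cases had : a = d <;> by_cases hbc : b = c <;> simp [had, hbc]

/-- The left regular representation on functions. -/
def regular (S : Type*) [Group S] : Representation ℂ S (S → ℂ) where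
  toFun s := LinearMap.funLeft ℂ ℂ (s⁻¹ * ·)
  map_one' := by ext; simp [LinearMap.funLeft]
  map_mul' s t := by ext; simp [LinearMap.funLeft, mul_assoc]

/-- The value `f t` is the value at `1` of the translate of `f` by `t⁻¹`. Evaluation at `1` is a
linear functional, so decomposing the regular representation turns it into matrix coefficients of
`t⁻¹`. -/
theorem exists_eq_sum_matrix (f : S → ℂ) :
    ∃ β : ∀ i, Fin (irr.dim i) → Fin (irr.dim i) → ℂ,
      ∀ t, f t = ∑ i, ∑ a, ∑ b, β i a b * irr.matrix i t⁻¹ a b := by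
  obtain ⟨n, e, he⟩ := irr.exists_decomposesInto (regular S)
  let l : ∀ i (m : Fin (n i)), (Fin (irr.dim i) → ℂ) →ₗ[ℂ] ℂ := fun i m =>
    LinearMap.proj (1 : S) ∘ₗ e.symm.toLinearMap ∘ₗ
      LinearMap.single ℂ (fun i => Fin (n i) → Fin (irr.dim i) → ℂ) i ∘ₗ
      LinearMap.single ℂ (fun _ : Fin (n i) => Fin (irr.dim i) → ℂ) m
  have hl : ∀ F, (e.symm F) 1 = ∑ i, ∑ m, l i m (F i m) := by
    intro F
    have hi : ∀ i, ∑ m, Pi.single (M := fun i => Fin (n i) → Fin (irr.dim i) → ℂ) i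
        (Pi.single m (F i m)) = Pi.single i (F i) := by
      intro i
      rw [← LinearMap.coe_single (R := ℂ), ← map_sum, Finset.univ_sum_single]
    have : ∑ i, ∑ m, Pi.single (M := fun i => Fin (n i) → Fin (irr.dim i) → ℂ) i
        (Pi.single m (F i m)) = F := by
      simp only [hi, Finset.univ_sum_single]
    conv_lhs => rw [← this]
    simp only [map_sum, Finset.sum_apply]
    rfl
  refine ⟨fun i a b => ∑ m, l i m (Pi.single a 1) * e f i m b, fun t => ?_⟩
  have h1 : f t = (e.symm (e (regular S t⁻¹ f))) 1 := by
    simp [regular, LinearMap.funLeft]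
  rw [h1, hl]
  refine Finset.sum_congr rfl fun i _ => ?_
  simp only [he, Finset.sum_mul]
  simp_rw [Finset.sum_comm (t := (Finset.univ : Finset (Fin (n i))))]
  refine Finset.sum_congr rfl fun m _ => ?_
  rw [LinearMap.pi_apply_eq_sum_univ]
  refine Finset.sum_congr rfl fun a _ => ?_
  rw [rep_apply, Finset.sum_smul]
  refine Finset.sum_congr rfl fun b _ => ?_
  have : (fun j => if a = j then (1 : ℂ) else 0) = Pi.single a 1 := by
    ext j; simp [Pi.single_apply, eq_comm]
  rw [this, smul_eq_mul]
  ring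

/-- Fourier inversion on a finite group. -/
theorem fourier_inversion (f : S → ℂ) (t : S) :
    f t = ∑ i, ((irr.dim i : ℂ) / Nat.card S) *
      ∑ a, ∑ b, (∑ s, irr.matrix i s b a * f s) * irr.matrix i t⁻¹ a b := by
  obtain ⟨β, hβ⟩ := irr.exists_eq_sum_matrix f
  -- Orthogonality isolates a single coefficient of the expansion, with the factor that the
  -- normalization in the formula cancels.
  have key : ∀ i a b, ∑ s, irr.matrix i s b a * f s = β i a b * (Nat.card S / irr.dim i) := by
    intro i a b
    simp only [hβ, Finset.mul_sum]
    rw [Finset.sum_comm, Finset.sum_eq_single i]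
    · rw [Finset.sum_comm, Finset.sum_eq_single a]
      · rw [Finset.sum_comm, Finset.sum_eq_single b]
        · simp only [mul_left_comm _ (β i a b)]
          rw [← Finset.mul_sum, sum_matrix_mul_matrix_inv_self]
          simp
        · intro d _ hd
          simp only [mul_left_comm _ (β i a d)]
          rw [← Finset.mul_sum, sum_matrix_mul_matrix_inv_self]
          simp [hd.symm]
        · simp
      · intro c _ hc
        rw [Finset.sum_comm]
        refine Finset.sum_eq_zero fun d _ => ?_
        simp only [mul_left_comm _ (β i c d)]
        rw [← Finset.mul_sum, sum_matrix_mul_matrix_inv_self]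
        simp [hc.symm]
      · simp
    · intro j _ hj
      rw [Finset.sum_comm]
      refine Finset.sum_eq_zero fun c _ => ?_
      rw [Finset.sum_comm]
      refine Finset.sum_eq_zero fun d _ => ?_
      simp only [mul_left_comm _ (β j c d)]
      rw [← Finset.mul_sum, sum_matrix_mul_matrix_inv_of_ne _ hj.symm, mul_zero]
    · simp
  rw [hβ]
  refine Finset.sum_congr rfl fun i _ => ?_
  have hd : (irr.dim i : ℂ) ≠ 0 := Nat.cast_ne_zero.mpr (irr.dim_pos i).ne'
  have hS : (Nat.card S : ℂ) ≠ 0 := Nat.cast_ne_zero.mpr Nat.card_pos.ne'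
  simp only [key, Finset.mul_sum]
  refine Finset.sum_congr rfl fun a _ => Finset.sum_congr rfl fun b _ => ?_
  field_simp

end IrrepSystem

/-! ### Basis vectors of the action algebra and induced modules -/

namespace ActionAlgebra

variable {X H : Type*} [Group H] [Finite H] [MulAction H X]

theorem sum_apply {α : Type*} (s : Finset α) (f : α → ActionAlgebra X H) (x : X) (h : H) :
    (∑ i ∈ s, f i) x h = ∑ i ∈ s, f i x h :=
  map_sum (coord x h) f s

theorem sum_single [Fintype X] [Fintype H] (a : ActionAlgebra X H) :
    ∑ x, ∑ h, a x h • single x h = a := by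
  ext x h
  simp only [sum_apply, smul_apply, single]
  rw [Finset.sum_eq_single x, Finset.sum_eq_single h]
  · simp
  · intro h' _ hh
    simp [hh.symm]
  · simp
  · intro x' _ hx
    simp [hx.symm]
  · simp

/-- The degree projections add up to the identity, so a vector whose components in all degrees
vanish is zero. -/
theorem sum_single_one [Fintype X] : ∑ x, single x 1 = (1 : ActionAlgebra X H) := by
  ext x h
  simp only [sum_apply, single, one_apply]
  rw [Finset.sum_eq_single x]
  · simp
  · intro x' _ hx
    simp [hx.symm]
  · simp

theorem single_mul [Fintype H] (x : X) (h : H) (a : ActionAlgebra X H) :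
    single x h * a = ∑ j, a (h⁻¹ • x) j • single x (h * j) := by
  ext y g
  rw [mul_apply, finsum_eq_sum_of_fintype, sum_apply]
  simp only [smul_apply, single]
  rw [Finset.sum_eq_single h, Finset.sum_eq_single (h⁻¹ * g)]
  · by_cases hy : y = x
    · subst hy; simp
    · simp [hy]
  · intro j _ hj
    have : g ≠ h * j := by
      rintro rfl
      simp at hj
    simp [this]
  · simp
  · intro j _ hj
    simp [hj]
  · simp

section

variable {S V : Type*} [Group S] [AddCommGroup V] [Module ℂ V] {ι : S →* H}
  {ρ : Representation ℂ S V}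

theorem indRep_apply [Fintype H] {x₀ : X} (hx₀ : ∀ s, ι s • x₀ = x₀) (a : ActionAlgebra X H)
    (f : indSpace ι ρ) (h : H) :
    (indRep ι ρ x₀ hx₀ a f).1 h = ∑ j : H, a (h • x₀) j • f.1 (j⁻¹ * h) := by
  rw [← finsum_eq_sum_of_fintype]
  rfl

theorem indRep_single_apply {x₀ : X} (hx₀ : ∀ s, ι s • x₀ = x₀) (x : X) (g : H)
    (f : indSpace ι ρ) (h : H) :
    (indRep ι ρ x₀ hx₀ (single x g) f).1 h = if h • x₀ = x then f.1 (g⁻¹ * h) else 0 := by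
  have := Fintype.ofFinite H
  rw [indRep_apply, Finset.sum_eq_single g]
  · by_cases hx : h • x₀ = x <;> simp [single, hx]
  · intro j _ hj
    simp [single, hj]
  · simp

variable (ι ρ) in
/-- The element of the induced space with value `v` at `1` and support the image of `S`. -/
def extendOne [Fintype S] : V →ₗ[ℂ] indSpace ι ρ where
  toFun v := ⟨fun h => ∑ s, if h * ι s = 1 then ρ s v else 0, by
    intro h t
    dsimp only
    rw [← Equiv.sum_comp (Equiv.mulLeft t⁻¹), map_sum]
    refine Finset.sum_congr rfl fun s _ => ?_
    by_cases hs : h * ι s = 1 <;> simp [mul_assoc, hs]⟩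
  map_add' v w := by
    ext h
    simp only [← Finset.sum_add_distrib, Submodule.coe_add, Pi.add_apply]
    refine Finset.sum_congr rfl fun s _ => ?_
    split_ifs <;> simp
  map_smul' a v := by
    ext h
    simp [Finset.smul_sum]

theorem extendOne_one [Fintype S] (hι : Function.Injective ι) (v : V) :
    (extendOne ι ρ v).1 1 = v := by
  change ∑ s, (if 1 * ι s = 1 then ρ s v else 0) = v
  rw [Finset.sum_eq_single 1]
  · simp
  · intro s _ hs
    rw [one_mul, if_neg]
    rwa [map_eq_one_iff ι hι]
  · simp

end

/-! ### Modules over the action algebra and representations of stabilizers -/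

section Fiber

variable {M : Type*} [AddCommGroup M] [Module ℂ M] (Φ : ActionAlgebra X H →ₐ[ℂ] Module.End ℂ M)

/-- The part of a module over the action algebra which sits in degree `x`. -/
def fiber (x : X) : Submodule ℂ M := LinearMap.eqLocus (Φ (single x 1)) LinearMap.id

theorem mem_fiber {x : X} {m : M} : m ∈ fiber Φ x ↔ Φ (single x 1) m = m := Iff.rfl

theorem map_single_mem_fiber (x : X) (h : H) (m : M) : Φ (single x h) m ∈ fiber Φ x := by
  rw [mem_fiber, ← Module.End.mul_apply, ← map_mul, single_mul_single]
  simp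

/-- The action of the stabilizer of a degree on the part which sits in this degree. -/
def fiberRep {S : Type*} [Group S] (ι : S →* H) (x : X) (hx : ∀ s, ι s • x = x) :
    Representation ℂ S (fiber Φ x) where
  toFun s := (Φ (single x (ι s))).restrict fun m _ => map_single_mem_fiber Φ x (ι s) m
  map_one' := by
    ext m
    change Φ (single x (ι 1)) m = m
    rw [map_one]
    exact m.2
  map_mul' s t := by
    ext m
    simp only [LinearMap.coe_restrict_apply, Module.End.mul_apply]
    rw [← Module.End.mul_apply, ← map_mul, single_mul_single, if_pos (hx s).symm, map_mul]

theorem fiberRep_apply {S : Type*} [Group S] (ι : S →* H) (x : X) (hx : ∀ s, ι s • x = x) (s : S)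
    (m : fiber Φ x) : (fiberRep Φ ι x hx s m : M) = Φ (single x (ι s)) m := rfl

variable {Φ} {𝓣 : Type*} {r : 𝓣 → X} {S : 𝓣 → Type*} [∀ T, Group (S T)] [∀ T, Fintype (S T)]
  {ι : ∀ T, S T →* H} {hr : ∀ T s, ι T s • r T = r T} {irr : ∀ T, IrrepSystem (S T)}
  {n : ∀ T, (irr T).idx → ℕ}

/-- In degree `r T` an induced module from the orbit of `r T` consists of functions supported on the
stabilizer, which are determined by their value at `1`; modules from other orbits vanish there. So
evaluation at `1` is the required equivalence. -/
theorem decomposesInto_fiberRep (hι : ∀ T, Function.Injective (ι T))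
    (hS : ∀ T h, h • r T = r T → ∃ s, ι T s = h) (hT : ∀ T T' (h : H), h • r T = r T' → T = T')
    (e : M ≃ₗ[ℂ] (∀ T, ∀ i : (irr T).idx, Fin (n T i) → indSpace (ι T) ((irr T).rep i)))
    (he : ∀ z m T i l, e (Φ z m) T i l =
      indRep (ι T) ((irr T).rep i) (r T) (hr T) z (e m T i l)) (T : 𝓣) :
    (irr T).DecomposesInto (fiberRep Φ (ι T) (r T) (hr T)) (n T) := by
  let g : fiber Φ (r T) →ₗ[ℂ] (∀ i, Fin (n T i) → Fin ((irr T).dim i) → ℂ) :=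
    { toFun := fun m i l => (e m T i l).1 1
      map_add' := fun v w => by ext; simp
      map_smul' := fun a v => by ext; simp }
  refine ⟨LinearEquiv.ofBijective g ⟨?_, ?_⟩, ?_⟩
  · rw [← LinearMap.ker_eq_bot, LinearMap.ker_eq_bot']
    rintro ⟨m, hm⟩ h0
    apply Subtype.ext
    apply e.injective
    change e m = e 0
    rw [map_zero, ← (mem_fiber Φ).mp hm]
    ext T' i l h a
    rw [he, indRep_single_apply]
    split_ifs with hx
    · obtain rfl := hT _ _ _ hx
      obtain ⟨s, rfl⟩ := hS _ _ hx
      have h1 := (e m T' i l).2 1 s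
      have h2 : (e m T' i l).1 1 = 0 := congrFun (congrFun h0 i) l
      rw [one_mul] at h1
      rw [inv_one, one_mul, h1, h2, map_zero]
      rfl
    · rfl
  · intro v
    -- The prescribed values at `1` are extended to functions on the group, by zero for the other
    -- orbits. Projecting to degree `r T` puts the result in the fiber without changing the values
    -- at `1`.
    let m := e.symm (Function.update 0 T fun i l => extendOne (ι T) ((irr T).rep i) (v i l))
    refine ⟨⟨Φ (single (r T) 1) m, map_single_mem_fiber _ _ _ _⟩, ?_⟩
    ext i l : 2
    change (e (Φ _ m) T i l).1 1 = _
    rw [he, indRep_single_apply]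
    simp [m, extendOne_one (hι T)]
  · intro s m i l
    change (e (Φ _ m) T i l).1 1 = (irr T).rep i s ((e m T i l).1 1)
    rw [he, indRep_single_apply]
    have h1 := (e m T i l).2 1 s⁻¹
    simp only [one_mul, map_inv, inv_inv] at h1
    simp [h1]

/-- Converse of the preceding lemma. A vector `m` is recorded by the functions sending `h` to the
component of `m` in degree `h • r T`, carried back to degree `r T` by `h⁻¹`. Since the orbits
exhaust `X`, nothing is lost. -/
theorem exists_linearEquiv_of_decomposesInto_fiberRep [Finite X] [Finite 𝓣]
    (hι : ∀ T, Function.Injective (ι T))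
    (hS : ∀ T h, h • r T = r T → ∃ s, ι T s = h) (hT : ∀ T T' (h : H), h • r T = r T' → T = T')
    (hX : ∀ x, ∃ T, ∃ h : H, x = h • r T)
    (hd : ∀ T, (irr T).DecomposesInto (fiberRep Φ (ι T) (r T) (hr T)) (n T)) :
    ∃ e : M ≃ₗ[ℂ] (∀ T, ∀ i : (irr T).idx, Fin (n T i) → indSpace (ι T) ((irr T).rep i)),
      ∀ z m T i l, e (Φ z m) T i l =
        indRep (ι T) ((irr T).rep i) (r T) (hr T) z (e m T i l) := by
  have := Fintype.ofFinite X
  have := Fintype.ofFinite H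
  have := Fintype.ofFinite 𝓣
  choose e he using hd
  let p : ∀ T (h : H), M →ₗ[ℂ] fiber Φ (r T) := fun T h =>
    (Φ (single (r T) h⁻¹)).codRestrict _ fun m => map_single_mem_fiber _ _ _ _
  have hp : ∀ T h s m, p T (h * ι T s) m = fiberRep Φ (ι T) (r T) (hr T) s⁻¹ (p T h m) := by
    intro T h s m
    apply Subtype.ext
    rw [fiberRep_apply]
    change Φ _ m = Φ _ (Φ _ m)
    rw [← Module.End.mul_apply, ← map_mul, single_mul_single, if_pos (hr T _).symm]
    simp
  let g : M → ∀ T, ∀ i : (irr T).idx, Fin (n T i) → indSpace (ι T) ((irr T).rep i) :=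
    fun m T i l => ⟨fun h => e T (p T h m) i l, fun h s => by beta_reduce; rw [hp, he]⟩
  let G : M →ₗ[ℂ] (∀ T, ∀ i : (irr T).idx, Fin (n T i) → indSpace (ι T) ((irr T).rep i)) :=
    { toFun := g
      map_add' := fun v w => by ext; simp [g]
      map_smul' := fun a v => by ext; simp [g] }
  refine ⟨LinearEquiv.ofBijective G ⟨?_, ?_⟩, ?_⟩
  · rw [← LinearMap.ker_eq_bot, LinearMap.ker_eq_bot']
    intro m h0
    have h1 : ∀ T h, p T h m = 0 := by
      intro T h
      apply (e T).injective
      rw [map_zero]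
      ext i l a
      exact congrFun (congrFun (congrArg Subtype.val (congrFun (congrFun (congrFun h0 T) i) l)) h) a
    have h2 : ∀ x, Φ (single x 1) m = 0 := by
      intro x
      obtain ⟨T, h, rfl⟩ := hX x
      have h3 : Φ (single (r T) h⁻¹) m = 0 := congrArg Subtype.val (h1 T h)
      have h4 : single (h • r T) (1 : H) = single (h • r T) h * single (r T) h⁻¹ := by
        rw [single_mul_single]; simp
      rw [h4, map_mul, Module.End.mul_apply, h3, map_zero]
    rw [← Module.End.one_apply (R := ℂ) m, ← map_one Φ, ← sum_single_one, map_sum,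
      LinearMap.sum_apply]
    exact Finset.sum_eq_zero fun x _ => h2 x
  · intro F
    let w : ∀ T, H → fiber Φ (r T) := fun T h => (e T).symm fun i l => (F T i l).1 h
    have hw : ∀ T h s, fiberRep Φ (ι T) (r T) (hr T) s (w T (h * ι T s)) = w T h := by
      intro T h s
      apply (e T).injective
      ext i l : 2
      simp only [he, w, LinearEquiv.apply_symm_apply, (F T i l).2 h s]
      rw [← Module.End.mul_apply, ← map_mul]
      simp
    -- Each value is carried from degree `r T` back to degree `h • r T`. By `hw` the summand depends
    -- only on the coset of `h` modulo the stabilizer, so every component occurs `Nat.card (S T)`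
    -- times.
    let m : M := ∑ T, (Nat.card (S T) : ℂ)⁻¹ • ∑ h, Φ (single (h • r T) h) (w T h)
    have hm : ∀ T h, p T h m = w T h := by
      intro T h
      apply Subtype.ext
      change Φ (single (r T) h⁻¹) m = _
      simp only [m, map_sum, map_smul]
      have h1 : ∀ T' h', Φ (single (r T) h⁻¹) (Φ (single (h' • r T') h') (w T' h')) =
          if r T = (h⁻¹ * h') • r T' then Φ (single (r T) (h⁻¹ * h')) (w T' h') else 0 := by
        intro T' h'
        rw [← Module.End.mul_apply, ← map_mul, single_mul_single, ← mul_smul]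
        split_ifs <;> simp
      simp only [h1]
      rw [Finset.sum_eq_single T]
      · rw [← Equiv.sum_comp (Equiv.mulLeft h)]
        have h2 : ∑ g, (if r T = (h⁻¹ * (Equiv.mulLeft h g)) • r T then
            Φ (single (r T) (h⁻¹ * (Equiv.mulLeft h g))) (w T (Equiv.mulLeft h g)) else 0) =
            ∑ s : S T, (w T h : M) := by
          rw [← Finset.sum_subset (Finset.subset_univ (Finset.univ.image (ι T))),
            Finset.sum_image (fun _ _ _ _ h => hι T h)]
          · refine Finset.sum_congr rfl fun s _ => ?_
            rw [← hw T h s, fiberRep_apply]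
            simp [hr]
          · intro g _ hg
            rw [if_neg]
            intro h3
            simp only [Equiv.coe_mulLeft, inv_mul_cancel_left] at h3
            obtain ⟨s, rfl⟩ := hS _ _ h3.symm
            simp at hg
        rw [h2]
        have : (Fintype.card (S T) : ℂ) ≠ 0 := Nat.cast_ne_zero.mpr Fintype.card_ne_zero
        rw [Finset.sum_const, Finset.card_univ, ← Nat.cast_smul_eq_nsmul ℂ, smul_smul,
          Nat.card_eq_fintype_card, inv_mul_cancel₀ this, one_smul]
      · intro T' _ hT'
        rw [Finset.sum_eq_zero, smul_zero]
        intro h' _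
        rw [if_neg]
        intro h3
        exact hT' (hT _ _ _ h3.symm)
      · simp
    refine ⟨m, ?_⟩
    ext T i l h : 5
    simp only [G, LinearMap.coe_mk, AddHom.coe_mk, g, hm, w, LinearEquiv.apply_symm_apply]
  · intro z m T i l
    ext h : 2
    rw [indRep_apply]
    change e T (p T h (Φ z m)) i l = ∑ j, z (h • r T) j • e T (p T (j⁻¹ * h) m) i l
    -- Multiplying `z` on the left by the basis vector `(r T, h⁻¹)` leaves only the coefficients of
    -- `z` in degree `h • r T`.
    have : p T h (Φ z m) = ∑ j, z (h • r T) j • p T (j⁻¹ * h) m := by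
      apply Subtype.ext
      change Φ (single (r T) h⁻¹) (Φ z m) = _
      rw [← Module.End.mul_apply, ← map_mul, single_mul]
      simp [p, LinearMap.sum_apply]
    rw [this]
    simp

end Fiber

end ActionAlgebra

/-! ### The fibers of a bulk excitation and Mackey's formula -/

section BulkToBoundary

variable {G : Type*} [Group G] [Finite G] {d : ℕ} (K : Subgroup G) (c : G)
  (π : Representation ℂ (centr c) (Fin d → ℂ))

/-- The restriction of the bulk excitation `(C, π)` to the boundary algebra. -/
def restrictedBulkRep : BoundaryAlgebra K →ₐ[ℂ] Module.End ℂ (bulkSpace c π) :=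
  (bulkRep c π).comp (boundaryInclusion K)

variable {K c π}

theorem bulkSpace_mul (f : bulkSpace c π) (g : G) (s : centr c) :
    f.1 (ConjAct.toConjAct (g * s)) = π s⁻¹ (f.1 (ConjAct.toConjAct g)) :=
  f.2 (ConjAct.toConjAct g) s

theorem restrictedBulkRep_single_apply (x : G ⧸ K) (k : K) (f : bulkSpace c π) (g : G) :
    (restrictedBulkRep K c π (single x k) f).1 (ConjAct.toConjAct g) =
      if (QuotientGroup.mk (g * c * g⁻¹) : G ⧸ K) = x then
        f.1 (ConjAct.toConjAct ((k : G)⁻¹ * g)) else 0 := by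
  have := Fintype.ofFinite (ConjAct G)
  change (indRep (centrHom c) π c (centrHom_smul c) (boundaryExtend K (single x k)) f).1 _ = _
  rw [indRep_apply, Finset.sum_eq_single (ConjAct.toConjAct (k : G))]
  · rw [boundaryExtend_pos _ _ (by simp)]
    have : (ConjAct.toConjAct g • c) = g * c * g⁻¹ := rfl
    rw [this]
    by_cases h : (QuotientGroup.mk (g * c * g⁻¹) : G ⧸ K) = x <;> simp [single, h]
  · intro j _ hj
    by_cases hjK : ConjAct.ofConjAct j ∈ K
    · rw [boundaryExtend_pos _ _ hjK]
      have : (⟨ConjAct.ofConjAct j, hjK⟩ : K) ≠ k := by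
        rintro rfl
        exact hj rfl
      simp [single, this]
    · simp [boundaryExtend_neg _ _ hjK]
  · simp

theorem mem_fiber_restrictedBulkRep {x : G ⧸ K} {f : bulkSpace c π} :
    f ∈ fiber (restrictedBulkRep K c π) x ↔
      ∀ g : G, (QuotientGroup.mk (g * c * g⁻¹) : G ⧸ K) ≠ x → f.1 (ConjAct.toConjAct g) = 0 := by
  rw [mem_fiber]
  constructor
  · intro h g hg
    rw [← h, restrictedBulkRep_single_apply, if_neg hg]
  · intro h
    apply Subtype.ext
    funext g
    obtain ⟨g, rfl⟩ := ConjAct.toConjAct.surjective g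
    rw [restrictedBulkRep_single_apply]
    split_ifs with hg
    · simp
    · rw [h g hg]

theorem mem_stab_iff {r k : G} :
    k ∈ stab K r ↔ k ∈ K ∧ (QuotientGroup.mk (k * r) : G ⧸ K) = QuotientGroup.mk r := by
  refine and_congr_right fun hk => ?_
  rw [eq_comm, QuotientGroup.eq]
  constructor
  · rintro ⟨y, hy, rfl⟩
    simpa [mul_assoc] using hy
  · intro h
    refine ⟨r⁻¹ * (k * r), h, ?_⟩
    change r * (r⁻¹ * (k * r)) * r⁻¹ = k
    group

/-- The set of `g` with `g c g⁻¹ ∈ r K` is stable under `E(C)` on the right, which fixes `c`, and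
under `K^r` on the left, since `k (x c x⁻¹) k⁻¹ K = k r K = r K`. -/
theorem mk_conj_mul {r x : G} (k : stab K r) (s : centr c)
    (hx : (QuotientGroup.mk (x * c * x⁻¹) : G ⧸ K) = QuotientGroup.mk r) :
    (QuotientGroup.mk ((k * x * s) * c * (k * x * s : G)⁻¹) : G ⧸ K) = QuotientGroup.mk r := by
  have hs : (s : G) * c * (s : G)⁻¹ = c := centrHom_smul c s
  have h1 : ((k * x * s) * c * (k * x * s : G)⁻¹) = k * (x * c * x⁻¹) * (k : G)⁻¹ := by
    calc _ = k * (x * (s * c * (s : G)⁻¹) * x⁻¹) * (k : G)⁻¹ := by group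
      _ = _ := by rw [hs]
  have h2 := (mem_stab_iff.mp k.2)
  rw [h1, ← h2.2]
  rw [QuotientGroup.eq] at hx ⊢
  have : (k * (x * c * x⁻¹) * (k : G)⁻¹)⁻¹ * (k * r) = k * ((x * c * x⁻¹)⁻¹ * r) := by group
  rw [this]
  exact K.mul_mem h2.1 hx

/-- A double coset of `K` and `E(C)` meets the support of the fiber in at most one double coset of
`K^r` and `E(C)`. Hence representatives of `K\G/E(C)` suffice in Mackey's formula. -/
theorem mem_stab_of_conj {r x k : G} (hk : k ∈ K) {s : G} (hs : s ∈ centr c)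
    (hx : (QuotientGroup.mk (x * c * x⁻¹) : G ⧸ K) = QuotientGroup.mk r)
    (hkx : (QuotientGroup.mk ((k * x * s) * c * (k * x * s)⁻¹) : G ⧸ K) = QuotientGroup.mk r) :
    k ∈ stab K r := by
  refine mem_stab_iff.mpr ⟨hk, ?_⟩
  have hs : s * c * s⁻¹ = c := centrHom_smul c ⟨s, hs⟩
  have h1 : ((k * x * s) * c * (k * x * s : G)⁻¹) = k * (x * c * x⁻¹) * (k : G)⁻¹ := by
    calc _ = k * (x * (s * c * (s : G)⁻¹) * x⁻¹) * (k : G)⁻¹ := by group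
      _ = _ := by rw [hs]
  rw [← hkx, h1]
  rw [QuotientGroup.eq] at hx ⊢
  have : (k * r)⁻¹ * (k * (x * c * x⁻¹) * k⁻¹) = ((x * c * x⁻¹)⁻¹ * r)⁻¹ * k⁻¹ := by group
  rw [this]
  exact K.mul_mem (K.inv_mem hx) (K.inv_mem hk)

variable (K c π) in
/-- The representation of `K^r` on the part of the bulk excitation in degree `rK`. -/
def bulkFiberRep (r : G) :
    Representation ℂ (stab K r) (fiber (restrictedBulkRep K c π) (r : G ⧸ K)) :=
  fiberRep (restrictedBulkRep K c π) (stabHom K r) r (stabHom_smul K r)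

theorem bulkFiberRep_apply {r : G} (s : stab K r)
    (f : fiber (restrictedBulkRep K c π) (r : G ⧸ K)) {g : G}
    (hg : (QuotientGroup.mk (g * c * g⁻¹) : G ⧸ K) = QuotientGroup.mk r) :
    (bulkFiberRep K c π r s f).1.1 (ConjAct.toConjAct g) =
      f.1.1 (ConjAct.toConjAct ((s : G)⁻¹ * g)) := by
  change (restrictedBulkRep K c π (single _ _) f.1).1 _ = _
  rw [restrictedBulkRep_single_apply, if_pos hg]
  rfl

variable {r : G} {e : ℕ} {R : Representation ℂ (stab K r) (Fin e → ℂ)}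

/-- The value at `x` of an intertwining map to the fiber of the bulk excitation. -/
def evalIntertwining {x : G} (hx : (QuotientGroup.mk (x * c * x⁻¹) : G ⧸ K) = QuotientGroup.mk r)
    (φ : R.IntertwiningMap (bulkFiberRep K c π r)) :
    (restrictBoundary K r c x R).IntertwiningMap (restrictBulk K r c x π) where
  toFun v := (φ v).1.1 (ConjAct.toConjAct x)
  map_add' v w := by simp
  map_smul' a v := by simp
  isIntertwining' y := by
    refine LinearMap.ext fun v => ?_
    change (φ (R (Subgroup.inclusion inf_le_right y) v)).1.1 (ConjAct.toConjAct x) =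
      π (conjCentrHom c x (Subgroup.inclusion inf_le_left y)) ((φ v).1.1 (ConjAct.toConjAct x))
    set s := conjCentrHom c x (Subgroup.inclusion inf_le_left y) with hs
    rw [φ.isIntertwining, bulkFiberRep_apply _ _ hx]
    -- Left translation of `x` by `y⁻¹` equals right translation by an element of `E(C)`, which acts
    -- through `π`.
    have h1 : ((Subgroup.inclusion inf_le_right y : stab K r) : G)⁻¹ * x = x * (s⁻¹ : centr c) := by
      rw [Subgroup.coe_inv, hs, conjCentrHom_apply]
      change (y : G)⁻¹ * x = x * (x⁻¹ * (y : G) * x)⁻¹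
      group
    rw [h1, bulkSpace_mul, inv_inv]

/-- The function on `G` supported on `K^r x E(C)` induced by a linear map. -/
def coinducedFun [Fintype (stab K r)] [Fintype (centr c)] (x : G)
    (R : Representation ℂ (stab K r) (Fin e → ℂ)) (ψ : (Fin e → ℂ) →ₗ[ℂ] (Fin d → ℂ)) :
    (Fin e → ℂ) →ₗ[ℂ] bulkSpace c π where
  -- The sum over all factorizations `g = k x s` avoids choosing one, so `ψ` may be any linear map
  -- and is averaged automatically.
  toFun v := ⟨fun g => ∑ k : stab K r, ∑ s : centr c,
    if (k : G) * x * s = ConjAct.ofConjAct g then π s⁻¹ (ψ (R k⁻¹ v)) else 0, by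
      intro g t
      beta_reduce
      rw [map_sum]
      refine Finset.sum_congr rfl fun k _ => ?_
      rw [← Equiv.sum_comp (Equiv.mulRight t), map_sum]
      refine Finset.sum_congr rfl fun s _ => ?_
      have h1 : (k : G) * x * (Equiv.mulRight t s : centr c) =
          ConjAct.ofConjAct (g * centrHom c t) ↔ (k : G) * x * s = ConjAct.ofConjAct g := by
        rw [map_mul]
        change (k : G) * x * (s * t) = ConjAct.ofConjAct g * t ↔ _
        rw [← mul_assoc, mul_left_inj]
      simp only [h1]
      split_ifs <;> simp⟩
  map_add' v w := by
    ext g : 2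
    simp only [Submodule.coe_add, Pi.add_apply, ← Finset.sum_add_distrib]
    refine Finset.sum_congr rfl fun k _ => Finset.sum_congr rfl fun s _ => ?_
    split_ifs <;> simp
  map_smul' a v := by
    ext g : 2
    simp only [Submodule.coe_smul, Pi.smul_apply, Finset.smul_sum, RingHom.id_apply]
    refine Finset.sum_congr rfl fun k _ => Finset.sum_congr rfl fun s _ => ?_
    split_ifs <;> simp

theorem coinducedFun_apply [Fintype (stab K r)] [Fintype (centr c)] (x : G)
    (ψ : (Fin e → ℂ) →ₗ[ℂ] (Fin d → ℂ)) (v : Fin e → ℂ) (g : G) :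
    (coinducedFun (π := π) x R ψ v).1 (ConjAct.toConjAct g) =
      ∑ k : stab K r, ∑ s : centr c,
        if (k : G) * x * s = g then π s⁻¹ (ψ (R k⁻¹ v)) else 0 := rfl

theorem coinducedFun_mem_fiber [Fintype (stab K r)] [Fintype (centr c)] {x : G}
    (hx : (QuotientGroup.mk (x * c * x⁻¹) : G ⧸ K) = QuotientGroup.mk r)
    (ψ : (Fin e → ℂ) →ₗ[ℂ] (Fin d → ℂ)) (v : Fin e → ℂ) :
    coinducedFun (π := π) x R ψ v ∈ fiber (restrictedBulkRep K c π) (r : G ⧸ K) := by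
  rw [mem_fiber_restrictedBulkRep]
  intro g hg
  rw [coinducedFun_apply]
  refine Finset.sum_eq_zero fun k _ => Finset.sum_eq_zero fun s _ => if_neg ?_
  rintro rfl
  exact hg (mk_conj_mul k s hx)

/-- The intertwining map to the fiber of the bulk excitation induced by a linear map. -/
def coinducedIntertwining [Fintype (stab K r)] [Fintype (centr c)] {x : G}
    (hx : (QuotientGroup.mk (x * c * x⁻¹) : G ⧸ K) = QuotientGroup.mk r)
    (R : Representation ℂ (stab K r) (Fin e → ℂ)) (ψ : (Fin e → ℂ) →ₗ[ℂ] (Fin d → ℂ)) :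
    R.IntertwiningMap (bulkFiberRep K c π r) where
  toLinearMap := (coinducedFun x R ψ).codRestrict _ (coinducedFun_mem_fiber hx ψ)
  isIntertwining' t := by
    refine LinearMap.ext fun v => ?_
    apply Subtype.ext
    apply Subtype.ext
    funext g
    obtain ⟨g, rfl⟩ := ConjAct.toConjAct.surjective g
    simp only [LinearMap.comp_apply]
    by_cases hg : (QuotientGroup.mk (g * c * g⁻¹) : G ⧸ K) = QuotientGroup.mk r
    · rw [bulkFiberRep_apply _ _ hg]
      simp only [LinearMap.codRestrict_apply, coinducedFun_apply]
      rw [← Equiv.sum_comp (Equiv.mulLeft t)]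
      refine Finset.sum_congr rfl fun k _ => Finset.sum_congr rfl fun s _ => ?_
      have h1 : ((Equiv.mulLeft t k : stab K r) : G) * x * s = g ↔
          (k : G) * x * s = (t : G)⁻¹ * g := by
        rw [eq_inv_mul_iff_mul_eq]
        simp [mul_assoc]
      simp only [h1]
      split_ifs <;> simp
    · rw [mem_fiber_restrictedBulkRep.mp (Subtype.property _) g hg,
        mem_fiber_restrictedBulkRep.mp (Subtype.property _) g hg]

/-- The factorizations `x = k x s` are those with `k` in `x E(C) x⁻¹ ∩ K^r` and `s = x⁻¹ k⁻¹ x`. As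
`ψ` is already equivariant, each of them contributes `ψ v`. -/
theorem coinducedFun_self [Fintype (stab K r)] [Fintype (centr c)] (x : G)
    (ψ : (restrictBoundary K r c x R).IntertwiningMap (restrictBulk K r c x π)) (v : Fin e → ℂ) :
    (coinducedFun (π := π) x R ψ.toLinearMap v).1 (ConjAct.toConjAct x) =
      (Nat.card (interGroup K r c x) : ℂ) • ψ v := by
  have := Fintype.ofFinite (interGroup K r c x)
  let ι : interGroup K r c x → stab K r := Subgroup.inclusion inf_le_right
  have hι : Function.Injective ι := Subgroup.inclusion_injective _
  rw [coinducedFun_apply, ← Finset.sum_subset (Finset.subset_univ (Finset.univ.image ι)),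
    Finset.sum_image (fun _ _ _ _ h => hι h), Finset.sum_congr rfl (g := fun _ => ψ v)]
  · simp [Nat.cast_smul_eq_nsmul]
  · intro y _
    let s : centr c := conjCentrHom c x (Subgroup.inclusion inf_le_left y)
    rw [Finset.sum_eq_single s⁻¹]
    · have h1 : ((ι y : stab K r) : G) * x * (s⁻¹ : centr c) = x := by
        rw [Subgroup.coe_inv, conjCentrHom_apply]
        change (y : G) * x * (x⁻¹ * (y : G) * x)⁻¹ = x
        group
      rw [if_pos h1, inv_inv]
      have h2 := ψ.isIntertwining _ _ y (R (ι y)⁻¹ v)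
      have h3 : restrictBoundary K r c x R y (R (ι y)⁻¹ v) = v := by
        change R (ι y) (R (ι y)⁻¹ v) = v
        rw [← Module.End.mul_apply, ← map_mul]
        simp
      rw [h3] at h2
      exact h2.symm
    · intro t _ ht
      rw [if_neg]
      intro h
      apply ht
      rw [eq_inv_iff_mul_eq_one, mul_eq_one_iff_inv_eq]
      apply Subtype.ext
      rw [conjCentrHom_apply, Subgroup.coe_inv, inv_eq_iff_mul_eq_one]
      have h' : (t : G) = x⁻¹ * (y : G)⁻¹ * x := by
        rw [mul_assoc, eq_inv_mul_iff_mul_eq, eq_inv_mul_iff_mul_eq, ← mul_assoc]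
        exact h
      rw [h']
      change x⁻¹ * (y : G)⁻¹ * x * (x⁻¹ * (y : G) * x) = 1
      group
    · simp
  · intro k _ hk
    refine Finset.sum_eq_zero fun s _ => if_neg fun h => hk ?_
    have hk' : (k : G) ∈ conjCentr c x := by
      refine ⟨(s : G)⁻¹, (centr c).inv_mem s.2, ?_⟩
      change x * (s : G)⁻¹ * x⁻¹ = k
      rw [mul_inv_eq_iff_eq_mul, mul_inv_eq_iff_eq_mul]
      exact h.symm
    exact Finset.mem_image.mpr ⟨⟨k, hk', k.2⟩, Finset.mem_univ _, rfl⟩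

/-- Evaluation at the points of `Y` is a bijection on intertwining maps. It is injective because
equivariance propagates the values over the double cosets that cover the support. It is surjective
because maps can be coinduced from each double coset separately. -/
theorem repMultiplicity_bulkFiberRep (R : Representation ℂ (stab K r) (Fin e → ℂ)) (Y : Set G)
    [Fintype Y] (hY : ∀ x ∈ Y, (QuotientGroup.mk (x * c * x⁻¹) : G ⧸ K) = QuotientGroup.mk r)
    (hYc : ∀ g : G, (QuotientGroup.mk (g * c * g⁻¹) : G ⧸ K) = QuotientGroup.mk r →
      ∃ x ∈ Y, ∃ (k : stab K r) (s : centr c), g = k * x * s)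
    (hYd : ∀ x ∈ Y, ∀ y ∈ Y, ∀ (k : stab K r) (s : centr c), (k : G) * x * s = y → x = y) :
    repMultiplicity (W := fiber (restrictedBulkRep K c π) (r : G ⧸ K)) R (bulkFiberRep K c π r) =
      ∑ x : Y, repMultiplicity (restrictBoundary K r c x R) (restrictBulk K r c x π) := by
  have := Fintype.ofFinite (stab K r)
  have := Fintype.ofFinite (centr c)
  let E : R.IntertwiningMap (bulkFiberRep K c π r) →ₗ[ℂ]
      (∀ x : Y, (restrictBoundary K r c x R).IntertwiningMap (restrictBulk K r c x π)) :=
    { toFun := fun φ x => evalIntertwining (hY x x.2) φ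
      map_add' := fun φ ψ => rfl
      map_smul' := fun a φ => rfl }
  have hE : Function.Bijective E := by
    constructor
    · intro φ φ' h0
      have h1 : ∀ x : Y, ∀ v, (φ v).1.1 (ConjAct.toConjAct (x : G)) =
          (φ' v).1.1 (ConjAct.toConjAct (x : G)) := fun x v =>
        DFunLike.congr_fun (congrFun h0 x) v
      refine IntertwiningMap.ext (LinearMap.ext fun v => ?_)
      apply Subtype.ext
      apply Subtype.ext
      funext g
      obtain ⟨g, rfl⟩ := ConjAct.toConjAct.surjective g
      change (φ v).1.1 _ = (φ' v).1.1 _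
      by_cases hg : (QuotientGroup.mk (g * c * g⁻¹) : G ⧸ K) = QuotientGroup.mk r
      · obtain ⟨x, hx, k, s, rfl⟩ := hYc g hg
        have h2 : ∀ φ : R.IntertwiningMap (bulkFiberRep K c π r),
            (φ v).1.1 (ConjAct.toConjAct (k * x)) =
              (φ (R k⁻¹ v)).1.1 (ConjAct.toConjAct x) := by
          intro φ
          rw [φ.isIntertwining, bulkFiberRep_apply k⁻¹ (φ v) (hY x hx)]
          simp
        rw [bulkSpace_mul, bulkSpace_mul, h2, h2, h1 ⟨x, hx⟩]
      · rw [mem_fiber_restrictedBulkRep.mp (φ v).2 g hg,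
          mem_fiber_restrictedBulkRep.mp (φ' v).2 g hg]
    · intro ψ
      have hEψ : ∀ (x y : Y) v,
          E (coinducedIntertwining (hY x x.2) R (ψ x).toLinearMap) y v =
            (coinducedFun (π := π) x R (ψ x).toLinearMap v).1 (ConjAct.toConjAct (y : G)) :=
        fun x y v => rfl
      -- The coinduced map of index `x` vanishes at the other points of `Y`, and at `x` it
      -- overcounts by the order of `interGroup K r c x`.
      refine ⟨∑ x : Y, (Nat.card (interGroup K r c x) : ℂ)⁻¹ •
        coinducedIntertwining (hY x x.2) R (ψ x).toLinearMap, ?_⟩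
      rw [map_sum]
      funext y
      rw [Finset.sum_apply, Finset.sum_eq_single y]
      · rw [map_smul, Pi.smul_apply]
        refine IntertwiningMap.ext (LinearMap.ext fun v => ?_)
        rw [IntertwiningMap.toLinearMap_smul, LinearMap.smul_apply,
          IntertwiningMap.toLinearMap_apply, hEψ]
        have : (Nat.card (interGroup K r c y) : ℂ) ≠ 0 := Nat.cast_ne_zero.mpr Nat.card_pos.ne'
        rw [coinducedFun_self, smul_smul, inv_mul_cancel₀ this, one_smul]
        rfl
      · intro x _ hx
        rw [map_smul, Pi.smul_apply]
        refine smul_eq_zero_of_right _ (IntertwiningMap.ext (LinearMap.ext fun v => ?_))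
        rw [IntertwiningMap.toLinearMap_apply, hEψ]
        change _ = 0
        rw [coinducedFun_apply]
        refine Finset.sum_eq_zero fun k _ => Finset.sum_eq_zero fun s _ => if_neg fun h => ?_
        exact hx (Subtype.ext (hYd x x.2 y y.2 k s h))
      · simp
  rw [repMultiplicity, (LinearEquiv.ofBijective E hE).finrank_eq, Module.finrank_pi_fintype]
  rfl

end BulkToBoundary

/-! ### Multiplicities of the boundary excitations -/

section Multiplicities

variable {G : Type*} [Group G] [Finite G] {d : ℕ} {K : Subgroup G}
  {r : DoubleCoset.Quotient (K : Set G) K → G} {irr : ∀ T, IrrepSystem (stab K (r T))} {c : G}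
  {π : Representation ℂ (centr c) (Fin d → ℂ)}

/-- The orbits of `K` on `G ⧸ K` are the double cosets. With `exists_eq_smul_mk` and
`exists_stabHom_eq` this supplies what the correspondence between modules and fibers requires. -/
theorem smul_mk_eq_mk_iff {T T' : DoubleCoset.Quotient (K : Set G) K}
    (hr : ∀ T, DoubleCoset.mk K K (r T) = T) (k : K)
    (h : k • (QuotientGroup.mk (r T) : G ⧸ K) = QuotientGroup.mk (r T')) : T = T' := by
  rw [← hr T, ← hr T', DoubleCoset.eq]
  have h' : (QuotientGroup.mk (k * r T) : G ⧸ K) = QuotientGroup.mk (r T') := h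
  rw [QuotientGroup.eq] at h'
  exact ⟨k, k.2, _, h', by group⟩

theorem exists_eq_smul_mk (hr : ∀ T, DoubleCoset.mk K K (r T) = T) (x : G ⧸ K) :
    ∃ T, ∃ k : K, x = k • (QuotientGroup.mk (r T) : G ⧸ K) := by
  obtain ⟨g, rfl⟩ := QuotientGroup.mk_surjective x
  obtain ⟨k, hk, l, hl, h⟩ := (DoubleCoset.eq K K (r (DoubleCoset.mk K K g)) g).mp (hr _)
  refine ⟨DoubleCoset.mk K K g, ⟨k, hk⟩, ?_⟩
  change _ = (QuotientGroup.mk (k * r _) : G ⧸ K)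
  rw [eq_comm, QuotientGroup.eq]
  have : (k * r (DoubleCoset.mk K K g))⁻¹ * g = l := by
    rw [inv_mul_eq_iff_eq_mul]
    exact h
  rwa [this]

theorem exists_stabHom_eq {r : G} (k : K) (h : k • (r : G ⧸ K) = (r : G ⧸ K)) :
    ∃ s, stabHom K r s = k :=
  ⟨⟨k, mem_stab_iff.mpr ⟨k.2, h⟩⟩, rfl⟩

theorem stabHom_injective (r : G) : Function.Injective (stabHom K r) :=
  Subgroup.inclusion_injective _

theorem decomposesWith_iff (hr : ∀ T, DoubleCoset.mk K K (r T) = T) (n : ∀ T, (irr T).idx → ℕ) :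
    DecomposesWith K r irr c π n ↔ ∀ T, ∀ i : (irr T).idx, n T i =
      repMultiplicity (W := fiber (restrictedBulkRep K c π) (r T : G ⧸ K)) ((irr T).rep i)
        (bulkFiberRep K c π (r T)) := by
  have := fun T => Fintype.ofFinite (stab K (r T))
  have : Finite (DoubleCoset.Quotient (K : Set G) K) := Quotient.finite _
  have h1 : DecomposesWith K r irr c π n ↔
      ∀ T, (irr T).DecomposesInto (V := fiber (restrictedBulkRep K c π) (r T : G ⧸ K))
        (bulkFiberRep K c π (r T)) (n T) := by
    constructor
    · rintro ⟨e, he⟩ T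
      exact decomposesInto_fiberRep (Φ := restrictedBulkRep K c π)
        (r := fun T => (r T : G ⧸ K)) (hr := fun T => stabHom_smul K (r T))
        (fun T => stabHom_injective (r T)) (fun T => exists_stabHom_eq)
        (fun T T' => smul_mk_eq_mk_iff hr) e he T
    · intro h
      exact exists_linearEquiv_of_decomposesInto_fiberRep (Φ := restrictedBulkRep K c π)
        (r := fun T => (r T : G ⧸ K)) (hr := fun T => stabHom_smul K (r T))
        (fun T => stabHom_injective (r T)) (fun T => exists_stabHom_eq)
        (fun T T' => smul_mk_eq_mk_iff hr) (exists_eq_smul_mk hr) h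
  rw [h1]
  exact forall_congr' fun T => (irr T).decomposesInto_iff

theorem condensationNumber_eq (T : DoubleCoset.Quotient (K : Set G) K) {X : Set G}
    (hX : ∀ g : G, ∃! x, x ∈ X ∧ DoubleCoset.mk K (centr c) x = DoubleCoset.mk K (centr c) g)
    (hXr : ∀ x ∈ X, x * c * x⁻¹ ∈ DoubleCoset.doubleCoset (r T) (K : Set G) K →
      (QuotientGroup.mk (x * c * x⁻¹) : G ⧸ K) = QuotientGroup.mk (r T))
    (irrInter : ∀ x, IrrepSystem (interGroup K (r T) c x)) {e : ℕ}
    (R : Representation ℂ (stab K (r T)) (Fin e → ℂ)) :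
    repMultiplicity (W := fiber (restrictedBulkRep K c π) (r T : G ⧸ K)) R
        (bulkFiberRep K c π (r T)) = condensationNumber K (r T) c π R X irrInter := by
  let Y : Set G := {x | x ∈ X ∧ x * c * x⁻¹ ∈ DoubleCoset.doubleCoset (r T) (K : Set G) K}
  have := Fintype.ofFinite Y
  have hsum : condensationNumber K (r T) c π R X irrInter = ∑ x : Y,
      repMultiplicity (restrictBoundary K (r T) c x R) (restrictBulk K (r T) c x π) := by
    rw [← finsum_eq_sum_of_fintype]
    refine Eq.trans ?_ (finsum_set_coe_eq_finsum_mem (f := fun x =>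
      repMultiplicity (restrictBoundary K (r T) c x R) (restrictBulk K (r T) c x π)) Y).symm
    refine finsum_congr fun x => finsum_congr fun _ => ?_
    rw [finsum_eq_sum_of_fintype, ← (irrInter x).repMultiplicity_eq_sum]
  rw [hsum]
  refine repMultiplicity_bulkFiberRep R Y (fun x hx => hXr x hx.1 hx.2) ?_ ?_
  · intro g hg
    obtain ⟨x, ⟨hxX, hx⟩, -⟩ := hX g
    obtain ⟨k, hk, s, hs, rfl⟩ := (DoubleCoset.eq K (centr c) x g).mp hx
    -- Writing `g = k x s`, the element `x c x⁻¹` is `k⁻¹ (g c g⁻¹) k` and so lies in `K r K`. The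
    -- special choice of `X` in `hXr` then strengthens this to `r K`.
    have hx2 : x * c * x⁻¹ ∈ DoubleCoset.doubleCoset (r T) (K : Set G) K := by
      rw [DoubleCoset.mem_doubleCoset]
      rw [eq_comm, QuotientGroup.eq] at hg
      refine ⟨k⁻¹, K.inv_mem hk, _, K.mul_mem hg hk, ?_⟩
      have hs' : s * c * s⁻¹ = c := centrHom_smul c ⟨s, hs⟩
      calc x * c * x⁻¹ = x * (s * c * s⁻¹) * x⁻¹ := by rw [hs']
        _ = _ := by group
    exact ⟨x, ⟨hxX, hx2⟩, ⟨k, mem_stab_of_conj hk hs (hXr x hxX hx2) hg⟩, ⟨s, hs⟩, rfl⟩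
  · intro x hx y hy k s h
    refine (hX y).unique ⟨hx.1, ?_⟩ ⟨hy.1, rfl⟩
    rw [DoubleCoset.eq]
    exact ⟨k, (mem_stab_iff.mp k.2).1, s, s.2, h.symm⟩

end Multiplicities

/-! ### Quantum dimensions as dimensions of spaces -/

section Dimensions

/-- An element of the induced space is determined by its values on coset representatives of the
image of `ι`, and these values are arbitrary. -/
theorem finrank_indSpace {H S V : Type*} [Group H] [Finite H] [Group S] [AddCommGroup V]
    [Module ℂ V] [FiniteDimensional ℂ V] {ι : S →* H} (hι : Function.Injective ι)
    (ρ : Representation ℂ S V) :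
    (Module.finrank ℂ (indSpace ι ρ) : ℚ) =
      (Nat.card H : ℚ) / Nat.card S * Module.finrank ℂ V := by
  have : Finite S := Finite.of_injective ι hι
  have := Fintype.ofFinite S
  have := Fintype.ofFinite (H ⧸ ι.range)
  let E : indSpace ι ρ →ₗ[ℂ] (H ⧸ ι.range → V) :=
    { toFun := fun f x => f.1 x.out
      map_add' := fun f g => rfl
      map_smul' := fun a f => rfl }
  have hE : Function.Bijective E := by
    constructor
    · intro f f' h
      ext g
      obtain ⟨⟨_, s, rfl⟩, hs⟩ := QuotientGroup.mk_out_eq_mul ι.range g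
      have h1 : g = (QuotientGroup.mk g : H ⧸ ι.range).out * ι s⁻¹ := by
        rw [hs]; simp
      rw [h1, f.2, f'.2]
      exact congrArg _ (congrFun h _)
    · intro u
      refine ⟨⟨fun h => ∑ s, if h * ι s = (QuotientGroup.mk h : H ⧸ ι.range).out then
        ρ s (u (QuotientGroup.mk h)) else 0, ?_⟩, ?_⟩
      · intro h t
        have h1 : (QuotientGroup.mk (h * ι t) : H ⧸ ι.range) = QuotientGroup.mk h :=
          QuotientGroup.mk_mul_of_mem h ⟨t, rfl⟩
        beta_reduce
        rw [h1, ← Equiv.sum_comp (Equiv.mulLeft t⁻¹), map_sum]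
        refine Finset.sum_congr rfl fun s _ => ?_
        simp only [Equiv.coe_mulLeft, map_mul, map_inv, mul_assoc, mul_inv_cancel_left]
        split_ifs
        · simp
        · simp
      · funext x
        change ∑ s, (if x.out * ι s = (QuotientGroup.mk x.out : H ⧸ ι.range).out then
          ρ s (u (QuotientGroup.mk x.out)) else 0) = u x
        rw [QuotientGroup.out_eq', Finset.sum_eq_single 1]
        · simp
        · intro s _ hs
          rw [if_neg]
          simpa [map_eq_one_iff ι hι] using hs
        · simp
  have h1 := (LinearEquiv.ofBijective E hE).finrank_eq
  rw [Module.finrank_pi_fintype] at h1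
  have h2 : Nat.card H = Nat.card (H ⧸ ι.range) * Nat.card S := by
    rw [Subgroup.card_eq_card_quotient_mul_card_subgroup ι.range,
      Nat.card_congr (MonoidHom.ofInjective hι).toEquiv]
  have h3 : (Nat.card S : ℚ) ≠ 0 := Nat.cast_ne_zero.mpr Nat.card_pos.ne'
  rw [h1, h2]
  simp only [Finset.sum_const, Finset.card_univ, smul_eq_mul, Nat.cast_mul, Nat.card_eq_fintype_card]
  rw [Nat.card_eq_fintype_card] at h3
  field_simp

variable {G : Type*} [Group G] [Finite G] {d : ℕ}

theorem finrank_boundarySpace {K : Subgroup G} {r : G} {e : ℕ}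
    (R : Representation ℂ (stab K r) (Fin e → ℂ)) :
    (Module.finrank ℂ (boundarySpace K r R) : ℚ) = boundaryFPdim K r e := by
  rw [finrank_indSpace (stabHom_injective r), boundaryFPdim]
  simp

theorem finrank_bulkSpace {c : G} (π : Representation ℂ (centr c) (Fin d → ℂ)) :
    (Module.finrank ℂ (bulkSpace c π) : ℚ) = bulkFPdim c d := by
  have hι : Function.Injective (centrHom c) := fun a b h => Subtype.ext h
  -- Orbit and stabilizer of `c` under conjugation are its class and its centralizer.
  have h1 : Nat.card (ConjAct G) = Nat.card {g : G // IsConj c g} * Nat.card (centr c) := by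
    rw [Subgroup.card_eq_card_quotient_mul_card_subgroup (MulAction.stabilizer (ConjAct G) c),
      ← Nat.card_congr (MulAction.orbitEquivQuotientStabilizer (ConjAct G) c)]
    congr 1
    · refine Nat.card_congr (Equiv.subtypeEquivRight fun g => ?_)
      rw [ConjAct.mem_orbit_conjAct, isConj_comm]
    · refine Nat.card_congr (Equiv.subtypeEquiv ConjAct.ofConjAct.toEquiv fun g => ?_)
      rw [MulAction.mem_stabilizer_iff, ConjAct.smul_def, mul_inv_eq_iff_eq_mul]
      exact Subgroup.mem_centralizer_singleton_iff.symm
  have h3 : (Nat.card (centr c) : ℚ) ≠ 0 := Nat.cast_ne_zero.mpr Nat.card_pos.ne'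
  rw [finrank_indSpace hι, h1, bulkFPdim, Nat.cast_mul, mul_div_cancel_right₀ _ h3]
  simp

theorem DecomposesWith.bulkFPdim_eq {K : Subgroup G}
    {r : DoubleCoset.Quotient (K : Set G) K → G} {irr : ∀ T, IrrepSystem (stab K (r T))} {c : G}
    {π : Representation ℂ (centr c) (Fin d → ℂ)} {n : ∀ T, (irr T).idx → ℕ}
    (h : DecomposesWith K r irr c π n) :
    bulkFPdim c d = ∑ᶠ T, ∑ᶠ i : (irr T).idx, (n T i : ℚ) *
      boundaryFPdim K (r T) ((irr T).dim i) := by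
  have : Finite (DoubleCoset.Quotient (K : Set G) K) := Quotient.finite _
  have := Fintype.ofFinite (DoubleCoset.Quotient (K : Set G) K)
  obtain ⟨e, -⟩ := h
  rw [← finrank_bulkSpace π, e.finrank_eq, finsum_eq_sum_of_fintype]
  simp only [Module.finrank_pi_fintype, finsum_eq_sum_of_fintype, Nat.cast_sum,
    finrank_boundarySpace]
  simp

end Dimensions

/-! ### The boundary ribbon operators as a basis of the dual -/

section RibbonExpansion

variable {G : Type*} [Group G] [Finite G] {K : Subgroup G}

theorem mk_conj_eq_smul (k : K) (r : G) :
    (QuotientGroup.mk ((k : G) * r * (k : G)⁻¹) : G ⧸ K) = k • (r : G ⧸ K) := by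
  change _ = (QuotientGroup.mk ((k : G) * r) : G ⧸ K)
  exact QuotientGroup.mk_mul_of_mem _ (K.inv_mem k.2)

theorem ribbonY_apply {r : G} [Fintype (stab K r)] (irr : IrrepSystem (stab K r))
    (q : K ⧸ (stab K r).subgroupOf K → K) (i : irr.idx) (u v : BoundaryIdx K r (irr.dim i))
    (z : BoundaryAlgebra K) :
    ribbonY K r (irr.rep i) q u v z = (irr.dim i : ℂ) / Nat.card (stab K r) *
      ∑ k, irr.matrix i k⁻¹ u.2 v.2 *
        z (q u.1 • (r : G ⧸ K)) (q u.1 * stabHom K r k * (q v.1)⁻¹) := by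
  rw [ribbonY, finsum_eq_sum_of_fintype, LinearMap.smul_apply, LinearMap.sum_apply, smul_eq_mul]
  congr 1
  refine Finset.sum_congr rfl fun k _ => ?_
  rw [← irr.matrix_inv, ← mk_conj_eq_smul]
  rfl

variable {r : DoubleCoset.Quotient (K : Set G) K → G} {irr : ∀ T, IrrepSystem (stab K (r T))}
  {q : ∀ T, K ⧸ (stab K (r T)).subgroupOf K → K}

variable (irr q) in
/-- The elements of the boundary algebra dual to the boundary ribbon operators. -/
def boundaryDual (T : DoubleCoset.Quotient (K : Set G) K) [Fintype (stab K (r T))] (i : (irr T).idx)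
    (u v : BoundaryIdx K (r T) ((irr T).dim i)) : BoundaryAlgebra K :=
  ∑ k, (irr T).matrix i k v.2 u.2 •
    single (q T u.1 • (r T : G ⧸ K)) (q T u.1 * stabHom K (r T) k * (q T v.1)⁻¹)

theorem representative_injective {S : Subgroup K} {q : K ⧸ S → K}
    (hq : ∀ x, QuotientGroup.mk (q x) = x) {x y : K ⧸ S} (h : (q x)⁻¹ * q y ∈ S) : x = y := by
  rw [← hq x, ← hq y, QuotientGroup.eq]
  exact h

theorem smul_mk_cancel {T : DoubleCoset.Quotient (K : Set G) K}
    (hq : ∀ T i, QuotientGroup.mk (q T i) = i) {x y : K ⧸ (stab K (r T)).subgroupOf K}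
    (h : q T x • (r T : G ⧸ K) = q T y • (r T : G ⧸ K)) : x = y := by
  refine representative_injective (hq T) ?_
  obtain ⟨s, hs⟩ := exists_stabHom_eq ((q T x)⁻¹ * q T y)
    (by rw [mul_smul, ← h, inv_smul_smul])
  rw [← hs]
  exact s.2

variable [∀ T, Fintype (stab K (r T))]

/-- In the coordinates `(x, k, y)` on the part of the boundary algebra over `T`, a ribbon operator
is supported on one pair of cosets and is there a matrix coefficient of `k⁻¹`. -/
theorem ribbonY_single {T : DoubleCoset.Quotient (K : Set G) K}
    (hq : ∀ T i, QuotientGroup.mk (q T i) = i) (i : (irr T).idx)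
    (u v : BoundaryIdx K (r T) ((irr T).dim i)) (x y : K ⧸ (stab K (r T)).subgroupOf K)
    (k : stab K (r T)) :
    ribbonY K (r T) ((irr T).rep i) (q T) u v
        (single (q T x • (r T : G ⧸ K)) (q T x * stabHom K (r T) k * (q T y)⁻¹)) =
      if u.1 = x ∧ v.1 = y then
        ((irr T).dim i : ℂ) / Nat.card (stab K (r T)) * (irr T).matrix i k⁻¹ u.2 v.2 else 0 := by
  rw [ribbonY_apply]
  split_ifs with h
  · obtain ⟨rfl, rfl⟩ := h
    congr 1
    rw [Finset.sum_eq_single k]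
    · simp [single]
    · intro l _ hl
      simp [single, (stabHom_injective (r T)).eq_iff, hl]
    · simp
  · refine mul_eq_zero_of_right _ (Finset.sum_eq_zero fun l _ => mul_eq_zero_of_right _ (if_neg ?_))
    rintro ⟨h1, h2⟩
    have hx : u.1 = x := smul_mk_cancel hq h1
    refine h ⟨hx, ?_⟩
    rw [hx, mul_assoc, mul_assoc, mul_right_inj] at h2
    refine representative_injective (hq T) ?_
    have h3 : (q T v.1)⁻¹ * q T y = stabHom K (r T) (l⁻¹ * k) := by
      rw [map_mul, map_inv, eq_inv_mul_iff_mul_eq, ← mul_assoc, h2]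
      group
    rw [h3]
    exact (l⁻¹ * k).2

theorem ribbonY_single_of_ne {T T' : DoubleCoset.Quotient (K : Set G) K}
    (hr : ∀ T, DoubleCoset.mk K K (r T) = T) (hT : T' ≠ T) (i : (irr T').idx)
    (u v : BoundaryIdx K (r T') ((irr T').dim i)) (x g : K) :
    ribbonY K (r T') ((irr T').rep i) (q T') u v (single (x • (r T : G ⧸ K)) g) = 0 := by
  rw [ribbonY_apply]
  refine mul_eq_zero_of_right _ (Finset.sum_eq_zero fun l _ => mul_eq_zero_of_right _ (if_neg ?_))
  rintro ⟨h1, -⟩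
  refine hT (smul_mk_eq_mk_iff hr (x⁻¹ * q T' u.1) ?_)
  rw [mul_smul, h1, inv_smul_smul]

theorem ribbonY_boundaryDual_of_ne {T T' : DoubleCoset.Quotient (K : Set G) K}
    (hr : ∀ T, DoubleCoset.mk K K (r T) = T) (hT : T' ≠ T) (i : (irr T').idx)
    (u v : BoundaryIdx K (r T') ((irr T').dim i)) (j : (irr T).idx)
    (x y : BoundaryIdx K (r T) ((irr T).dim j)) :
    ribbonY K (r T') ((irr T').rep i) (q T') u v (boundaryDual irr q T j x y) = 0 := by
  rw [boundaryDual, map_sum]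
  exact Finset.sum_eq_zero fun k _ => by rw [map_smul, ribbonY_single_of_ne hr hT, smul_zero]

theorem ribbonY_boundaryDual {T : DoubleCoset.Quotient (K : Set G) K}
    (hq : ∀ T i, QuotientGroup.mk (q T i) = i) (i : (irr T).idx)
    (u v : BoundaryIdx K (r T) ((irr T).dim i)) (j : (irr T).idx)
    (x y : BoundaryIdx K (r T) ((irr T).dim j)) :
    ribbonY K (r T) ((irr T).rep i) (q T) u v (boundaryDual irr q T j x y) =
      if u.1 = x.1 ∧ v.1 = y.1 then ((irr T).dim i : ℂ) / Nat.card (stab K (r T)) *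
        ∑ k, (irr T).matrix j k y.2 x.2 * (irr T).matrix i k⁻¹ u.2 v.2 else 0 := by
  rw [boundaryDual, map_sum]
  simp only [map_smul, ribbonY_single hq, smul_eq_mul]
  split_ifs
  · rw [Finset.mul_sum]
    exact Finset.sum_congr rfl fun k _ => by ring
  · simp

theorem ribbonY_boundaryDual_of_idx_ne {T : DoubleCoset.Quotient (K : Set G) K}
    (hq : ∀ T i, QuotientGroup.mk (q T i) = i) {i j : (irr T).idx} (hij : i ≠ j)
    (u v : BoundaryIdx K (r T) ((irr T).dim i)) (x y : BoundaryIdx K (r T) ((irr T).dim j)) :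
    ribbonY K (r T) ((irr T).rep i) (q T) u v (boundaryDual irr q T j x y) = 0 := by
  rw [ribbonY_boundaryDual hq, (irr T).sum_matrix_mul_matrix_inv_of_ne hij.symm]
  simp

theorem ribbonY_boundaryDual_self {T : DoubleCoset.Quotient (K : Set G) K}
    (hq : ∀ T i, QuotientGroup.mk (q T i) = i) (i : (irr T).idx)
    (u v x y : BoundaryIdx K (r T) ((irr T).dim i)) :
    ribbonY K (r T) ((irr T).rep i) (q T) u v (boundaryDual irr q T i x y) =
      if u = x ∧ v = y then 1 else 0 := by
  rw [ribbonY_boundaryDual hq, (irr T).sum_matrix_mul_matrix_inv_self]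
  have h1 : ((irr T).dim i : ℂ) ≠ 0 := Nat.cast_ne_zero.mpr ((irr T).dim_pos i).ne'
  have h2 : (Nat.card (stab K (r T)) : ℂ) ≠ 0 := Nat.cast_ne_zero.mpr Nat.card_pos.ne'
  obtain ⟨u1, u2⟩ := u
  obtain ⟨v1, v2⟩ := v
  obtain ⟨x1, x2⟩ := x
  obtain ⟨y1, y2⟩ := y
  simp only [Prod.mk.injEq, eq_comm (a := v2), eq_comm (a := u2)]
  by_cases hu1 : u1 = x1
  · by_cases hv1 : v1 = y1
    · by_cases hu2 : x2 = u2
      · by_cases hv2 : y2 = v2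
        · simp only [hu1, hv1, hu2, hv2, and_self, if_true]
          field_simp
        · simp [hv2]
      · simp [hu2]
    · simp [hv1]
  · simp [hu1]

/-- Duality with the elements `boundaryDual` isolates each coefficient, which gives uniqueness of
the expansion. -/
theorem coefficient_eq_of_eq_sum (hr : ∀ T, DoubleCoset.mk K K (r T) = T)
    (hq : ∀ T i, QuotientGroup.mk (q T i) = i) {L : Module.Dual ℂ (BoundaryAlgebra K)}
    {a : ∀ T, ∀ i : (irr T).idx, BoundaryIdx K (r T) ((irr T).dim i) →
      BoundaryIdx K (r T) ((irr T).dim i) → ℂ}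
    (h : L = ∑ᶠ T, ∑ᶠ i, ∑ᶠ u, ∑ᶠ v, a T i u v • ribbonY K (r T) ((irr T).rep i) (q T) u v)
    (T : DoubleCoset.Quotient (K : Set G) K) (i : (irr T).idx)
    (u v : BoundaryIdx K (r T) ((irr T).dim i)) : a T i u v = L (boundaryDual irr q T i u v) := by
  have : Finite (DoubleCoset.Quotient (K : Set G) K) := Quotient.finite _
  have := Fintype.ofFinite (DoubleCoset.Quotient (K : Set G) K)
  have := fun T => Fintype.ofFinite (K ⧸ (stab K (r T)).subgroupOf K)
  simp only [finsum_eq_sum_of_fintype] at h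
  simp only [h, LinearMap.sum_apply, LinearMap.smul_apply, smul_eq_mul]
  rw [Finset.sum_eq_single T, Finset.sum_eq_single i, Finset.sum_eq_single u,
    Finset.sum_eq_single v]
  · simp [ribbonY_boundaryDual_self hq]
  · intro v' _ hv
    simp [ribbonY_boundaryDual_self hq, hv]
  · simp
  · intro u' _ hu
    simp [ribbonY_boundaryDual_self hq, hu]
  · simp
  · intro j _ hj
    simp [ribbonY_boundaryDual_of_idx_ne hq hj]
  · simp
  · intro T' _ hT
    simp [ribbonY_boundaryDual_of_ne hr hT]
  · simp

theorem exists_coordinates (hr : ∀ T, DoubleCoset.mk K K (r T) = T)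
    (hq : ∀ T i, QuotientGroup.mk (q T i) = i) (x : G ⧸ K) (g : K) :
    ∃ (T : DoubleCoset.Quotient (K : Set G) K) (y z : K ⧸ (stab K (r T)).subgroupOf K)
      (k : stab K (r T)), x = q T y • (r T : G ⧸ K) ∧
        g = q T y * stabHom K (r T) k * (q T z)⁻¹ := by
  obtain ⟨T, l, rfl⟩ := exists_eq_smul_mk hr x
  have hy : ∀ l : K, ∃ s : stab K (r T), l⁻¹ * q T (QuotientGroup.mk l) = stabHom K (r T) s := by
    intro l
    have h := QuotientGroup.eq.mp (hq T (QuotientGroup.mk l)).symm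
    exact ⟨⟨_, h⟩, rfl⟩
  obtain ⟨s, hs⟩ := hy l
  rw [inv_mul_eq_iff_eq_mul] at hs
  -- The second coset is that of `g⁻¹ q_y`, where `q_y` represents the first one: its representative
  -- `q_z` equals `g⁻¹ q_y k`, so `g = q_y k q_z⁻¹`.
  obtain ⟨k, hk⟩ := hy (g⁻¹ * q T (QuotientGroup.mk l))
  refine ⟨T, QuotientGroup.mk l, QuotientGroup.mk (g⁻¹ * q T (QuotientGroup.mk l)), k, ?_, ?_⟩
  · rw [hs, mul_smul, stabHom_smul]
  · rw [← hk]
    group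

/-- Every functional on the boundary algebra is a combination of boundary ribbon operators. -/
theorem eq_sum_ribbonY (hr : ∀ T, DoubleCoset.mk K K (r T) = T)
    (hq : ∀ T i, QuotientGroup.mk (q T i) = i) (L : Module.Dual ℂ (BoundaryAlgebra K)) :
    L = ∑ᶠ T, ∑ᶠ i, ∑ᶠ u, ∑ᶠ v,
      L (boundaryDual irr q T i u v) • ribbonY K (r T) ((irr T).rep i) (q T) u v := by
  have : Finite (DoubleCoset.Quotient (K : Set G) K) := Quotient.finite _
  have := Fintype.ofFinite (DoubleCoset.Quotient (K : Set G) K)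
  have := fun T => Fintype.ofFinite (K ⧸ (stab K (r T)).subgroupOf K)
  have := Fintype.ofFinite (G ⧸ K)
  have := Fintype.ofFinite K
  simp only [finsum_eq_sum_of_fintype]
  refine LinearMap.ext fun z => ?_
  rw [← sum_single z]
  simp only [map_sum, map_smul]
  refine Finset.sum_congr rfl fun x _ => Finset.sum_congr rfl fun g _ => ?_
  congr 1
  obtain ⟨T, y, z, k, rfl, rfl⟩ := exists_coordinates hr hq x g
  simp only [LinearMap.sum_apply, LinearMap.smul_apply, smul_eq_mul]
  -- For a fixed pair of cosets `L` is a function on `stab K (r T)`. Its Fourier coefficients are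
  -- the values of `L` on the dual elements.
  rw [Finset.sum_eq_single T, (irr T).fourier_inversion (fun k => L (single
    (q T y • (r T : G ⧸ K)) (q T y * stabHom K (r T) k * (q T z)⁻¹))) k]
  · refine Finset.sum_congr rfl fun i _ => ?_
    simp only [ribbonY_single hq, Fintype.sum_prod_type]
    rw [Finset.sum_eq_single y, Finset.mul_sum]
    · refine Finset.sum_congr rfl fun a _ => ?_
      rw [Finset.sum_eq_single z, Finset.mul_sum]
      · refine Finset.sum_congr rfl fun b _ => ?_
        simp only [boundaryDual, map_sum, map_smul, smul_eq_mul, and_self, if_true]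
        ring
      · intro z' _ hz
        simp [hz]
      · simp
    · intro y' _ hy
      simp [hy]
    · simp
  · intro T' _ hT
    simp [ribbonY_single_of_ne hr hT]
  · simp

end RibbonExpansion

/-! ### Nonvanishing of the condensation coefficients -/

section Nonvanishing

variable {G : Type*} [Group G] [Finite G] {d : ℕ} {K : Subgroup G} {c : G}
  {π : Representation ℂ (centr c) (Fin d → ℂ)}

theorem toMatrix'_apply_single {m n : ℕ} (f : (Fin n → ℂ) →ₗ[ℂ] (Fin m → ℂ)) (a : Fin m)
    (b : Fin n) : LinearMap.toMatrix' f a b = f (Pi.single b 1) a := by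
  rw [← LinearMap.toMatrix'_mulVec f (Pi.single b 1)]
  simp

theorem condense_ribbonF_apply [Fintype (centr c)] (p : G ⧸ centr c → G) (u v : BulkIdx c d)
    (z : BoundaryAlgebra K) :
    condense K (ribbonF c π p u v) z = ((d : ℂ) / Nat.card (centr c)) *
      ∑ s, π s⁻¹ (Pi.single v.2 1) u.2 * boundaryExtend K z (p u.1 * c * (p u.1)⁻¹)
        (ConjAct.toConjAct (p u.1 * (s : G) * (p v.1)⁻¹)) := by
  change ribbonF c π p u v (boundaryExtend K z) = _
  rw [ribbonF, finsum_eq_sum_of_fintype, LinearMap.smul_apply, LinearMap.sum_apply, smul_eq_mul]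
  congr 1
  refine Finset.sum_congr rfl fun s _ => ?_
  have h : (LinearMap.toMatrix' (π s))⁻¹ = LinearMap.toMatrix' (π s⁻¹) := by
    apply Matrix.inv_eq_left_inv
    rw [← LinearMap.toMatrix'_mul, ← map_mul]
    simp
  rw [h, LinearMap.smul_apply, smul_eq_mul, toMatrix'_apply_single]
  rfl

theorem boundaryExtend_single (x : G ⧸ K) (k : K) (h g : G) :
    boundaryExtend K (single x k) h (ConjAct.toConjAct g) =
      if (h : G ⧸ K) = x ∧ g = k then 1 else 0 := by
  by_cases hg : g ∈ K
  · rw [boundaryExtend_pos _ _ (by simpa using hg)]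
    simp [single, Subtype.ext_iff]
  · rw [boundaryExtend_neg _ _ (by simpa using hg), if_neg]
    rintro ⟨-, rfl⟩
    exact hg k.2

theorem boundaryExtend_sum {α : Type*} (s : Finset α) (f : α → BoundaryAlgebra K) (h : G)
    (g : ConjAct G) : boundaryExtend K (∑ i ∈ s, f i) h g = ∑ i ∈ s, boundaryExtend K (f i) h g :=
  map_sum ((coord h g : Module.Dual ℂ (QuantumDouble G)) ∘ₗ (boundaryInclusion K).toLinearMap) f s

theorem boundaryExtend_smul (a : ℂ) (z : BoundaryAlgebra K) (h : G) (g : ConjAct G) :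
    boundaryExtend K (a • z) h g = a * boundaryExtend K z h g :=
  map_smul ((coord h g : Module.Dual ℂ (QuantumDouble G)) ∘ₗ (boundaryInclusion K).toLinearMap) a z

theorem mk_conj_inv_mul_iff (k : K) (g r : G) :
    (QuotientGroup.mk (((k : G)⁻¹ * g) * c * ((k : G)⁻¹ * g)⁻¹) : G ⧸ K) = QuotientGroup.mk r ↔
      (QuotientGroup.mk (g * c * g⁻¹) : G ⧸ K) = k • (r : G ⧸ K) := by
  rw [← inv_smul_eq_iff, ← mk_conj_eq_smul]
  simp [mul_assoc]

variable {r : DoubleCoset.Quotient (K : Set G) K → G} {irr : ∀ T, IrrepSystem (stab K (r T))}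
  {q : ∀ T, K ⧸ (stab K (r T)).subgroupOf K → K} [∀ T, Fintype (stab K (r T))]
  [Fintype (centr c)]

/-- Pairing the sum over `E(C)` with the sum over `K^r` keeps the pairs with `q k q'⁻¹ = p s p'⁻¹`,
that is `k⁻¹ (q⁻¹ p) s = q'⁻¹ p'`. These are the factorizations in `coinducedFun`, applied to a
matrix unit. -/
theorem condense_ribbonF_boundaryDual (p : G ⧸ centr c → G) (u₁ v₁ : BulkIdx c d)
    (T : DoubleCoset.Quotient (K : Set G) K) (i : (irr T).idx)
    (u₂ v₂ : BoundaryIdx K (r T) ((irr T).dim i)) :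
    condense K (ribbonF c π p u₁ v₁) (boundaryDual irr q T i u₂ v₂) =
      if (QuotientGroup.mk ((((q T u₂.1 : K) : G)⁻¹ * p u₁.1) * c *
        (((q T u₂.1 : K) : G)⁻¹ * p u₁.1)⁻¹) : G ⧸ K) = QuotientGroup.mk (r T) then
      ((d : ℂ) / Nat.card (centr c)) *
        (coinducedFun (π := π) (((q T u₂.1 : K) : G)⁻¹ * p u₁.1) ((irr T).rep i)
          (Matrix.toLin' (Matrix.single v₁.2 v₂.2 1)) (Pi.single u₂.2 1)).1
          (ConjAct.toConjAct (((q T v₂.1 : K) : G)⁻¹ * p v₁.1)) u₁.2 else 0 := by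
  rw [condense_ribbonF_apply]
  simp only [boundaryDual, boundaryExtend_sum, boundaryExtend_smul, boundaryExtend_single,
    mk_conj_inv_mul_iff]
  split_ifs with h
  · congr 1
    -- The element `k` of the dual basis sum corresponds to `k⁻¹` in the factorization.
    rw [coinducedFun_apply, ← Equiv.sum_comp (Equiv.inv (stab K (r T))), Finset.sum_comm,
      Finset.sum_apply]
    refine Finset.sum_congr rfl fun s _ => ?_
    rw [Finset.mul_sum, Finset.sum_apply]
    refine Finset.sum_congr rfl fun k _ => ?_
    have hk : ((Equiv.inv (stab K (r T)) k : stab K (r T)) : G) *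
        (((q T u₂.1 : K) : G)⁻¹ * p u₁.1) * s = ((q T v₂.1 : K) : G)⁻¹ * p v₁.1 ↔
        p u₁.1 * (s : G) * (p v₁.1)⁻¹ =
          ((q T u₂.1 * stabHom K (r T) k * (q T v₂.1)⁻¹ : K) : G) := by
      change (k : G)⁻¹ * (((q T u₂.1 : K) : G)⁻¹ * p u₁.1) * s = _ ↔
        _ = ((q T u₂.1 : K) : G) * k * ((q T v₂.1 : K) : G)⁻¹
      rw [mul_inv_eq_iff_eq_mul, mul_assoc, inv_mul_eq_iff_eq_mul, mul_assoc,
        inv_mul_eq_iff_eq_mul]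
      simp only [mul_assoc]
    simp only [hk, h, true_and]
    split_ifs with hs
    · have h1 : Matrix.toLin' (Matrix.single v₁.2 v₂.2 (1 : ℂ))
          ((irr T).rep i (Equiv.inv (stab K (r T)) k)⁻¹ (Pi.single u₂.2 1)) =
          (irr T).matrix i k v₂.2 u₂.2 • Pi.single v₁.2 1 := by
        rw [Matrix.toLin'_apply, Matrix.single_mulVec, IrrepSystem.matrix,
          toMatrix'_apply_single]
        ext b
        simp [Pi.single_apply, Function.update]
      rw [h1, map_smul, Pi.smul_apply, smul_eq_mul]
      ring
    · simp
  · simp [h]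

/-- The values of the functions induced by linear maps, as a bilinear map. -/
def coinducedBilin {r : G} [Fintype (stab K r)] {e : ℕ} (x g : G)
    (R : Representation ℂ (stab K r) (Fin e → ℂ)) (π : Representation ℂ (centr c) (Fin d → ℂ)) :
    ((Fin e → ℂ) →ₗ[ℂ] (Fin d → ℂ)) →ₗ[ℂ] (Fin e → ℂ) →ₗ[ℂ] (Fin d → ℂ) :=
  LinearMap.mk₂ ℂ (fun ψ v => (coinducedFun (π := π) x R ψ v).1 (ConjAct.toConjAct g))
    (fun ψ ψ' v => by
      simp only [coinducedFun_apply, ← Finset.sum_add_distrib]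
      refine Finset.sum_congr rfl fun k _ => Finset.sum_congr rfl fun s _ => ?_
      split_ifs <;> simp)
    (fun a ψ v => by
      simp only [coinducedFun_apply, Finset.smul_sum]
      refine Finset.sum_congr rfl fun k _ => Finset.sum_congr rfl fun s _ => ?_
      split_ifs <;> simp)
    (fun ψ v v' => by simp)
    (fun a ψ v => by simp)

/-- The value is bilinear in `ψ` and `v`, so it cannot vanish on all matrix units and basis vectors.
-/
theorem exists_coinducedFun_single_ne_zero {r : G} [Fintype (stab K r)] {e : ℕ} {x g : G}
    {R : Representation ℂ (stab K r) (Fin e → ℂ)} {ψ : (Fin e → ℂ) →ₗ[ℂ] (Fin d → ℂ)}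
    {v : Fin e → ℂ} (h : (coinducedFun (π := π) x R ψ v).1 (ConjAct.toConjAct g) ≠ 0) :
    ∃ b a a' b', (coinducedFun (π := π) x R (Matrix.toLin' (Matrix.single b a 1))
      (Pi.single a' 1)).1 (ConjAct.toConjAct g) b' ≠ 0 := by
  by_contra! h0
  apply h
  change coinducedBilin x g R π ψ v = 0
  have h1 : ∀ b a, coinducedBilin x g R π (Matrix.toLin' (Matrix.single b a 1)) = 0 := by
    intro b a
    ext a' b'
    exact h0 b a a' b'
  have h2 : coinducedBilin x g R π ∘ₗ Matrix.toLin'.toLinearMap = 0 := by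
    refine LinearMap.ext fun A => ?_
    rw [Matrix.matrix_eq_sum_single A, map_sum]
    refine Finset.sum_eq_zero fun b _ => ?_
    rw [map_sum]
    refine Finset.sum_eq_zero fun a _ => ?_
    have h4 : Matrix.single b a (A b a) = A b a • Matrix.single b a (1 : ℂ) := by
      rw [Matrix.smul_single, smul_eq_mul, mul_one]
    rw [h4, map_smul, LinearMap.comp_apply, LinearEquiv.coe_coe, h1, smul_zero]
  rw [← Matrix.toLin'_toMatrix' ψ]
  have h3 := LinearMap.congr_fun h2 (LinearMap.toMatrix' ψ)
  exact LinearMap.congr_fun h3 v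

theorem exists_condense_ribbonF_ne_zero_iff (hd : d ≠ 0)
    (hq : ∀ T i, QuotientGroup.mk (q T i) = i) {p : G ⧸ centr c → G}
    (hp : ∀ i, QuotientGroup.mk (p i) = i) (T : DoubleCoset.Quotient (K : Set G) K)
    (i : (irr T).idx) :
    (∃ u₁ v₁ u₂ v₂, condense K (ribbonF c π p u₁ v₁) (boundaryDual irr q T i u₂ v₂) ≠ 0) ↔
      ∃ x : G, (QuotientGroup.mk (x * c * x⁻¹) : G ⧸ K) = QuotientGroup.mk (r T) ∧
        repMultiplicity (restrictBoundary K (r T) c x ((irr T).rep i))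
          (restrictBulk K (r T) c x π) ≠ 0 := by
  simp only [condense_ribbonF_boundaryDual, repMultiplicity_ne_zero]
  constructor
  · rintro ⟨u₁, v₁, u₂, v₂, h⟩
    rw [ite_ne_right_iff] at h
    obtain ⟨hx, h⟩ := h
    have h1 := right_ne_zero_of_mul h
    set g := ((q T v₂.1 : K) : G)⁻¹ * p v₁.1 with hg
    set R := (irr T).rep i
    -- A nonzero coefficient is an entry of the value at `g` of an intertwining map into the fiber.
    -- Evaluating that map at `g` gives the required map, so `g` serves as the point of the
    -- conclusion.
    set φ := coinducedIntertwining (π := π) hx R (Matrix.toLin' (Matrix.single v₁.2 v₂.2 1))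
    have h2 : (φ (Pi.single u₂.2 1)).1.1 (ConjAct.toConjAct g) ≠ 0 := fun h0 => h1 (congrFun h0 _)
    have hgc : (QuotientGroup.mk (g * c * g⁻¹) : G ⧸ K) = QuotientGroup.mk (r T) := by
      by_contra hgc
      exact h2 (mem_fiber_restrictedBulkRep.mp (φ (Pi.single u₂.2 1)).2 g hgc)
    refine ⟨g, hgc, evalIntertwining hgc φ, fun h0 => h2 ?_⟩
    exact DFunLike.congr_fun h0 (Pi.single u₂.2 1)
  · rintro ⟨x, hx, ψ, hψ⟩
    -- The coefficients see only points of the form `q⁻¹ p`, so `x` is moved inside `K^r x E(C)` to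
    -- such a point `g = k x s`. Here `q` represents the trivial coset, where it lies in `K^r` but
    -- need not be `1`.
    obtain ⟨s, hs⟩ : ∃ s : centr c, p (QuotientGroup.mk x) = x * s := by
      have h := QuotientGroup.eq.mp (hp (QuotientGroup.mk x)).symm
      exact ⟨⟨_, h⟩, by simp⟩
    obtain ⟨k, hk⟩ : ∃ k : stab K (r T), stabHom K (r T) k = (q T (QuotientGroup.mk 1))⁻¹ := by
      have h := QuotientGroup.eq.mp (hq T (QuotientGroup.mk 1))
      rw [mul_one] at h
      exact ⟨⟨_, h⟩, rfl⟩
    have hk' : ((q T (QuotientGroup.mk 1) : K) : G)⁻¹ = k := (congrArg Subtype.val hk).symm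
    set g : G := k * x * s with hg
    have hgc : (QuotientGroup.mk (g * c * g⁻¹) : G ⧸ K) = QuotientGroup.mk (r T) :=
      mk_conj_mul k s hx
    set φ := coinducedIntertwining (π := π) hx ((irr T).rep i) ψ.toLinearMap
    have h1 : ∃ v, (φ v).1.1 (ConjAct.toConjAct g) ≠ 0 := by
      by_contra! h0
      apply hψ
      refine IntertwiningMap.ext (LinearMap.ext fun v => ?_)
      have h2 := h0 ((irr T).rep i k v)
      rw [hg, bulkSpace_mul, φ.isIntertwining, bulkFiberRep_apply] at h2
      · have h3 := congrArg (π s) h2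
        rw [← Module.End.mul_apply, ← map_mul, mul_inv_cancel, map_one, map_zero,
          Module.End.one_apply, inv_mul_cancel_left] at h3
        change (coinducedFun (π := π) x ((irr T).rep i) ψ.toLinearMap v).1 (ConjAct.toConjAct x) = 0 at h3
        rw [coinducedFun_self] at h3
        exact (smul_eq_zero.mp h3).resolve_left (Nat.cast_ne_zero.mpr Nat.card_pos.ne')
      · simpa using mk_conj_mul k (1 : centr c) hx
    obtain ⟨v, hv⟩ := h1
    -- Coinducing again, now from `g` to `g`, only multiplies the value by the order of the
    -- intersection group, so it remains nonzero before passing to matrix units.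
    have h4 : (coinducedFun (π := π) g ((irr T).rep i) (evalIntertwining hgc φ).toLinearMap v).1
        (ConjAct.toConjAct g) ≠ 0 := by
      rw [coinducedFun_self]
      exact smul_ne_zero (Nat.cast_ne_zero.mpr Nat.card_pos.ne') hv
    obtain ⟨b, a, a', b', h5⟩ := exists_coinducedFun_single_ne_zero h4
    refine ⟨⟨QuotientGroup.mk x, b'⟩, ⟨QuotientGroup.mk x, b⟩, ⟨QuotientGroup.mk 1, a'⟩,
      ⟨QuotientGroup.mk 1, a⟩, ?_⟩
    dsimp only
    have h6 : ((q T (QuotientGroup.mk 1) : K) : G)⁻¹ * p (QuotientGroup.mk x) = g := by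
      rw [hk', hs, hg, mul_assoc]
    rw [h6, if_pos hgc]
    refine mul_ne_zero (div_ne_zero (Nat.cast_ne_zero.mpr hd)
      (Nat.cast_ne_zero.mpr Nat.card_pos.ne')) h5

theorem inter_doubleCoset_nonempty {r x : G}
    (hx : (QuotientGroup.mk (x * c * x⁻¹) : G ⧸ K) = QuotientGroup.mk r) :
    ({g : G | IsConj c g} ∩ DoubleCoset.doubleCoset r (K : Set G) K).Nonempty := by
  refine ⟨x * c * x⁻¹, isConj_iff.mpr ⟨x, rfl⟩, ?_⟩
  rw [DoubleCoset.mem_doubleCoset]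
  exact ⟨1, K.one_mem, _, QuotientGroup.eq.mp hx.symm, by group⟩

end Nonvanishing
end

/-! ### The condensation theorem -/

theorem mainTheorem2 {G : Type*} [Group G] [Finite G] (K : Subgroup G)
    -- representatives of the double cosets, of the irreducible representations of their
    -- stabilizers and of the cosets of the stabilizers
    (r : DoubleCoset.Quotient (K : Set G) K → G)
    (hr : ∀ T, DoubleCoset.mk K K (r T) = T)
    (irr : ∀ T, IrrepSystem (stab K (r T)))
    (q : ∀ T, K ⧸ (stab K (r T)).subgroupOf K → K)
    (hq : ∀ T i, QuotientGroup.mk (q T i) = i)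
    -- the bulk excitation, and representatives of the cosets of the centralizer
    (c : G) {d : ℕ} (π : Representation ℂ (centr c) (Fin d → ℂ)) (hπ : π.IsIrreducible)
    (p : G ⧸ centr c → G) (hp : ∀ i, QuotientGroup.mk (p i) = i)
    -- representatives of the double cosets of `K` and the centralizer
    (X : Set G)
    (hX : ∀ g : G, ∃! x, x ∈ X ∧ DoubleCoset.mk K (centr c) x = DoubleCoset.mk K (centr c) g)
    (hXr : ∀ x ∈ X, ∀ T, x * c * x⁻¹ ∈ DoubleCoset.doubleCoset (r T) (K : Set G) K →
      (QuotientGroup.mk (x * c * x⁻¹) : G ⧸ K) = QuotientGroup.mk (r T))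
    (irrInter : ∀ T x, IrrepSystem (interGroup K (r T) c x)) :
    (∃ a, IsExpansion K r irr q c π p a ∧
      (∀ a', IsExpansion K r irr q c π p a' → a' = a) ∧
      ∀ T, ∀ i : (irr T).idx,
        (∃ u₁ v₁ u₂ v₂, a u₁ v₁ T i u₂ v₂ ≠ 0) ↔
          ({g : G | IsConj c g} ∩ DoubleCoset.doubleCoset (r T) (K : Set G) K).Nonempty ∧
          ∃ x : G, (QuotientGroup.mk (x * c * x⁻¹) : G ⧸ K) = QuotientGroup.mk (r T) ∧
            ∃ (e : ℕ) (σ : Representation ℂ (interGroup K (r T) c x) (Fin e → ℂ)),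
              σ.IsIrreducible ∧
              repMultiplicity σ (restrictBulk K (r T) c x π) ≠ 0 ∧
              repMultiplicity σ (restrictBoundary K (r T) c x ((irr T).rep i)) ≠ 0) ∧
    (∀ n : ∀ T, (irr T).idx → ℕ, DecomposesWith K r irr c π n ↔
      ∀ T, ∀ i : (irr T).idx,
        n T i = condensationNumber K (r T) c π ((irr T).rep i) X (irrInter T)) ∧
    bulkFPdim c d = ∑ᶠ T, ∑ᶠ i : (irr T).idx,
      (condensationNumber K (r T) c π ((irr T).rep i) X (irrInter T) : ℚ) *
        boundaryFPdim K (r T) ((irr T).dim i) := by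
  have := fun T => Fintype.ofFinite (stab K (r T))
  have := Fintype.ofFinite (centr c)
  -- The zero space has a single subrepresentation, so it is not irreducible. This keeps the factor
  -- `d / |E(C)|` of the ribbon operators nonzero.
  have hd : d ≠ 0 := by
    rintro rfl
    have : Subsingleton (Subrepresentation π) := ⟨fun A B => by
      ext v
      rw [Subsingleton.elim v 0]
      exact ⟨fun _ => B.toSubmodule.zero_mem, fun _ => A.toSubmodule.zero_mem⟩⟩
    exact not_nontrivial (Subrepresentation π) hπ.toNontrivial
  have hn : ∀ n : ∀ T, (irr T).idx → ℕ, DecomposesWith K r irr c π n ↔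
      ∀ T, ∀ i : (irr T).idx,
        n T i = condensationNumber K (r T) c π ((irr T).rep i) X (irrInter T) := by
    intro n
    rw [decomposesWith_iff hr]
    refine forall_congr' fun T => forall_congr' fun i => ?_
    rw [condensationNumber_eq T hX (fun x hx => hXr x hx T) (irrInter T)]
  refine ⟨⟨fun u₁ v₁ T i u₂ v₂ => condense K (ribbonF c π p u₁ v₁) (boundaryDual irr q T i u₂ v₂),
    fun u₁ v₁ => eq_sum_ribbonY hr hq _, ?_, ?_⟩, hn,
    ((hn _).mpr fun T i => rfl : DecomposesWith K r irr c π _).bulkFPdim_eq⟩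
  · intro a' ha'
    funext u₁ v₁ T i u₂ v₂
    exact coefficient_eq_of_eq_sum hr hq (ha' u₁ v₁) T i u₂ v₂
  · intro T i
    rw [exists_condense_ribbonF_ne_zero_iff hd hq hp]
    constructor
    -- The condition that `C` meets `T` follows from the existence of `x`, since `x c x⁻¹` lies in
    -- both.
    · rintro ⟨x, hx, h⟩
      exact ⟨inter_doubleCoset_nonempty hx, x, hx,
        (repMultiplicity_ne_zero_iff (irrInter T x) _ _).mp h⟩
    · rintro ⟨-, x, hx, h⟩
      exact ⟨x, hx, (repMultiplicity_ne_zero_iff (irrInter T x) _ _).mpr h⟩
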